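/- For an open set $A\subset\mathbb C$ and $z\in A$, the Teichmüller density is $\lambda_A(z)=\inf_V\|\bar\partial V\|_{L^\infty(A)}$, the infimum being taken over all continuous functions $V:\overline A\to\mathbb C$ with $V(z)=1$ and $V=0$ on $\partial A$, whose distributional derivative $\bar\partial V=\frac12(\partial_xV+i\,\partial_yV)$ on $A$ belongs to $L^\infty(A)$, and which, if $A$ is unbounded, vanish as vector fields at the boundary point $\infty$ of $A$, that is, $V(w)/w^2\to0$ as $w\to\infty$ in $A$. Here $\overline A$ and $\partial A$ are the closure and boundary in $\mathbb C$. Let $d(A,B)=\inf\{|z-w|:z\in A,\,w\in B\}$, and let $H(A,B)$ be the (Euclidean) Hausdorff distance. Theorem. Let $U\subset\mathbb C$ be a bounded domain and $K\subset U$ a compact set. There is a constant $C$, depending only on $d(K,\partial U)$ and on the diameter of $U$, such that for every $z_0\in U$ there is $\varepsilon_0>0$ (which may depend on $U$, $K$ and $z_0$) with the following property. If $0<\varepsilon<\varepsilon_0$ and $W\subset\mathbb C$ is a domain with $H(\partial U,\partial W)\le\varepsilon$, then $$|\lambda_U(w)-\lambda_W(w)|\le \frac{C}{\log\log(1/\varepsilon)}\qquad\text{for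 all } w\in K\cap W .$$ Moreover, if in addition $z_0\in W$, then $K\subset W$, so that the inequality holds for all $w\in K$. -/

import Mathlib

open Filter Topology MeasureTheory
open scoped ContDiff ENNReal

/-- The Euclidean distance `d(A, B) = inf {|z - w| : z ∈ A, w ∈ B}` between two sets. -/
noncomputable def setDist (A B : Set ℂ) : ℝ :=
  sInf (Set.image2 dist A B)

/-- The Wirtinger derivative `∂̄φ = (∂φ/∂x + i ∂φ/∂y) / 2` of a (real) differentiable function. -/
noncomputable def dbar (φ : ℂ → ℂ) (w : ℂ) : ℂ :=
  (1 / 2 : ℂ) * (fderiv ℝ φ w 1 + Complex.I * fderiv ℝ φ w Complex.I)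

/-- `μ` is the distributional derivative `∂̄V` of `V` on the open set `A`:
`∫_A V ∂̄φ = - ∫_A μ φ` for every smooth `φ` with compact support in `A`. -/
def HasWeakDbar (A : Set ℂ) (V μ : ℂ → ℂ) : Prop :=
  ∀ φ : ℂ → ℂ, ContDiff ℝ ∞ φ → HasCompactSupport φ → tsupport φ ⊆ A →
    ∫ w in A, V w * dbar φ w = - ∫ w in A, μ w * φ w

/-- The vector fields `V` on `A` that vanish on the boundary of `A` and satisfy `V z = 1`.
The boundary is taken in the Riemann sphere. In the coordinate `t = 1 / w` at infinity the vector
field `V(w) d/dw` reads `-(V(w) / w ^ 2) d/dt`, so if `A` is unbounded, vanishing at the boundary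
point `∞` means that `V(w) / w ^ 2 → 0` as `w → ∞` in `A`; if `A` is bounded, the last condition is
void. Only the values of `V` on the closure of `A` matter. -/
structure IsTeichmullerField (A : Set ℂ) (z : ℂ) (V : ℂ → ℂ) : Prop where
  continuousOn : ContinuousOn V (closure A)
  map_point : V z = 1
  map_frontier : ∀ ζ ∈ frontier A, V ζ = 0
  map_infty : Tendsto (fun w => V w / w ^ 2) (Bornology.cobounded ℂ ⊓ 𝓟 A) (𝓝 0)

/-- The Teichmüller density `λ_A(z)` of the open set `A` at `z ∈ A`: the infimum of the `L^∞(A)`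
norm of the distributional derivative `∂̄V` over the vector fields `V` on `A` that vanish on the
boundary of `A`, satisfy `V z = 1`, and have `∂̄V` in `L^∞(A)`. -/
noncomputable def teichmullerDensity (A : Set ℂ) (z : ℂ) : ℝ :=
  sInf {M : ℝ | ∃ V μ : ℂ → ℂ, IsTeichmullerField A z V ∧ HasWeakDbar A V μ ∧
    MemLp μ ∞ (volume.restrict A) ∧ M = (eLpNorm μ ∞ (volume.restrict A)).toReal}

open scoped Convolution

/-! Both densities are infima. It therefore suffices to turn each field `V` admissible for `A` into
one admissible for `B`, where `A` and `B` are `U` and `W` in either order, while its norm grows by a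
factor `1 + O(1 / log log (1/ε))` (`exists_competitor`). The new field is `χV`, with a cutoff `χ`
vanishing close to `∂A` and hence on `∂B`. In `∂̄(χV) = χ ∂̄V + V ∂̄χ` only the last term costs
anything. With `M = ‖∂̄V‖_∞`, the field is `O(M r log (1/r))` at distance `r` from `∂A`
(`norm_le_of_vanish`). Since `∫ dr / (r log (1/r))` diverges like `log log`, a cutoff can pass from
0 to 1 with gradient `O(1 / (r log (1/r) log log (1/ε)))` (`exists_log_cutoff`), and the product is
`O(M / log log (1/ε))`.

The growth bound comes from the Cauchy–Pompeiu formula at `z` and at two zeros `ζ₀`, `ζ₁` of `V`.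
The combination whose kernel has three poles decays like `|w|⁻³`, just enough against `V = o(w²)`,
and its integral has only a logarithmic singularity as `z → ζ₀`.

This formula needs a bounded `∂̄`-derivative on the whole plane for the extension of `V` by zero,
with no regularity of `∂A`. That is a Radó-type theorem (`exists_hasWeakDbar_univ`). One tests with
`φ k(|f|²)`, where `f` is a mollification of `V` and `k` vanishes near 0. The error involves the
gradient of `f` in the layer `|f| ~ δ`; a Caccioppoli inequality controls it uniformly in `δ`, while
the measure of the layer tends to 0.

A bump function bounds the densities in terms of `d(K, ∂U)`, which makes the factor an additive
error. Finally `K ⊆ W` holds because `K` is joined to `z₀` by connected sets at a fixed distance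
from `∂U`, which cannot meet `∂W` when `ε` is small. -/

/-! ### Calculus of `∂̄` and integration by parts. -/

lemma dbar_mul {f g : ℂ → ℂ} {w : ℂ} (hf : DifferentiableAt ℝ f w) (hg : DifferentiableAt ℝ g w) :
    dbar (fun z => f z * g z) w = dbar f w * g w + f w * dbar g w := by
  unfold dbar
  rw [fderiv_fun_mul hf hg]
  simp only [add_apply, smul_apply, smul_eq_mul]
  ring

lemma norm_dbar_le (f : ℂ → ℂ) (w : ℂ) :
    ‖dbar f w‖ ≤ (‖fderiv ℝ f w 1‖ + ‖fderiv ℝ f w Complex.I‖) / 2 := by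
  unfold dbar
  rw [norm_mul]
  have := norm_add_le (fderiv ℝ f w 1) (Complex.I * fderiv ℝ f w Complex.I)
  rw [norm_mul, Complex.norm_I, one_mul] at this
  norm_num
  linarith

lemma norm_dbar_le_norm_fderiv (f : ℂ → ℂ) (w : ℂ) : ‖dbar f w‖ ≤ ‖fderiv ℝ f w‖ := by
  have h1 := (fderiv ℝ f w).le_opNorm 1
  have h2 := (fderiv ℝ f w).le_opNorm Complex.I
  have := norm_dbar_le f w
  simp at h1 h2
  linarith

lemma continuous_dbar {f : ℂ → ℂ} (hf : ContDiff ℝ ∞ f) : Continuous (dbar f) := by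
  have h := hf.continuous_fderiv (by simp)
  unfold dbar
  fun_prop

lemma hasCompactSupport_dbar {f : ℂ → ℂ} (hf : HasCompactSupport f) :
    HasCompactSupport (dbar f) := by
  have h := hf.fderiv ℝ
  refine h.mono' ?_
  intro z hz
  by_contra hz'
  apply hz
  unfold dbar
  rw [image_eq_zero_of_notMem_tsupport hz']
  simp

lemma support_dbar_subset (f : ℂ → ℂ) : Function.support (dbar f) ⊆ tsupport f := by
  intro z hz
  by_contra hz'
  apply hz
  unfold dbar
  have : fderiv ℝ f z = 0 := by
    by_contra h
    exact hz' (support_fderiv_subset ℝ h)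
  simp [this]

/-- Integration by parts for a constant-direction derivative against a compactly supported
function. -/
lemma integral_mul_fderiv_apply {f g : ℂ → ℂ} (hf : ContDiff ℝ 1 f) (hg : ContDiff ℝ 1 g)
    (hgc : HasCompactSupport g) (v : ℂ) :
    ∫ z, f z * fderiv ℝ g z v = - ∫ z, fderiv ℝ f z v * g z := by
  have hf' : Continuous fun z => fderiv ℝ f z v := (hf.continuous_fderiv (by simp)).clm_apply continuous_const
  have hg' : Continuous fun z => fderiv ℝ g z v := (hg.continuous_fderiv (by simp)).clm_apply continuous_const
  have hgc' : HasCompactSupport fun z => fderiv ℝ g z v := hgc.fderiv_apply ℝ v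
  apply integral_mul_fderiv_eq_neg_fderiv_mul_of_integrable
  · exact (hf'.mul hg.continuous).integrable_of_hasCompactSupport hgc.mul_left
  · exact (hf.continuous.mul hg').integrable_of_hasCompactSupport hgc'.mul_left
  · exact (hf.continuous.mul hg.continuous).integrable_of_hasCompactSupport hgc.mul_left
  · exact fun x _ => hf.differentiable (by simp) x
  · exact fun x _ => hg.differentiable (by simp) x

lemma integral_mul_dbar {f g : ℂ → ℂ} (hf : ContDiff ℝ 1 f) (hg : ContDiff ℝ 1 g)
    (hgc : HasCompactSupport g) :
    ∫ z, f z * dbar g z = - ∫ z, dbar f z * g z := by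
  have hf' (v : ℂ) : Continuous fun z => fderiv ℝ f z v := (hf.continuous_fderiv (by simp)).clm_apply continuous_const
  have hg' (v : ℂ) : Continuous fun z => fderiv ℝ g z v := (hg.continuous_fderiv (by simp)).clm_apply continuous_const
  have hgc' (v : ℂ) : HasCompactSupport fun z => fderiv ℝ g z v := hgc.fderiv_apply ℝ v
  have i1 (v : ℂ) : Integrable fun z => fderiv ℝ f z v * g z :=
    ((hf' v).mul hg.continuous).integrable_of_hasCompactSupport hgc.mul_left
  have i2 (v : ℂ) : Integrable fun z => f z * fderiv ℝ g z v :=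
    (hf.continuous.mul (hg' v)).integrable_of_hasCompactSupport (hgc' v).mul_left
  have e1 : ∀ z, f z * dbar g z = (1/2 : ℂ) * (f z * fderiv ℝ g z 1)
      + (Complex.I / 2) * (f z * fderiv ℝ g z Complex.I) := by
    intro z; unfold dbar; ring
  have e2 : ∀ z, dbar f z * g z = (1/2 : ℂ) * (fderiv ℝ f z 1 * g z)
      + (Complex.I / 2) * (fderiv ℝ f z Complex.I * g z) := by
    intro z; unfold dbar; ring
  simp_rw [e1, e2]
  rw [integral_add ((i2 1).const_mul _) ((i2 _).const_mul _),
    integral_add ((i1 1).const_mul _) ((i1 _).const_mul _)]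
  simp_rw [integral_const_mul]
  rw [integral_mul_fderiv_apply hf hg hgc, integral_mul_fderiv_apply hf hg hgc]
  ring

/-- The Jacobian form `df ∧ dg` has integral zero when `g` has compact support. -/
lemma integral_jacobian_eq_zero {f g : ℂ → ℂ} (hf : ContDiff ℝ ∞ f) (hg : ContDiff ℝ ∞ g)
    (hgc : HasCompactSupport g) :
    ∫ z, (fderiv ℝ f z 1 * fderiv ℝ g z Complex.I - fderiv ℝ f z Complex.I * fderiv ℝ g z 1) = 0 := by
  have hf' (v : ℂ) : ContDiff ℝ ∞ fun z => fderiv ℝ f z v :=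
    (hf.fderiv_right (by simp)).clm_apply contDiff_const
  have hg' (v : ℂ) : Continuous fun z => fderiv ℝ g z v := (hg.continuous_fderiv (by simp)).clm_apply continuous_const
  have hgc' (v : ℂ) : HasCompactSupport fun z => fderiv ℝ g z v := hgc.fderiv_apply ℝ v
  have i2 (u v : ℂ) : Integrable fun z => fderiv ℝ f z u * fderiv ℝ g z v :=
    ((hf' u).continuous.mul (hg' v)).integrable_of_hasCompactSupport (hgc' v).mul_left
  rw [integral_sub (i2 _ _) (i2 _ _),
    integral_mul_fderiv_apply ((hf' _).of_le (by simp)) (hg.of_le (by simp)) hgc,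
    integral_mul_fderiv_apply ((hf' _).of_le (by simp)) (hg.of_le (by simp)) hgc]
  have hsymm : ∀ z, fderiv ℝ (fun z => fderiv ℝ f z 1) z Complex.I
      = fderiv ℝ (fun z => fderiv ℝ f z Complex.I) z 1 := by
    intro z
    have hd : DifferentiableAt ℝ (fderiv ℝ f) z :=
      (hf.fderiv_right (m := ∞) (by simp)).differentiable (by simp) z
    have e (v : ℂ) : fderiv ℝ (fun z => fderiv ℝ f z v) z = (fderiv ℝ (fderiv ℝ f) z).flip v := by
      rw [fderiv_clm_apply hd (by fun_prop)]
      simp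
    rw [e, e]
    simp only [ContinuousLinearMap.flip_apply]
    exact ((contDiff_infty.1 hf 2).contDiffAt.isSymmSndFDerivAt (by simp)) _ _
  simp_rw [hsymm]
  ring

/-! ### A weighted Caccioppoli inequality. -/

/-- The left side is `Im (f_x G_y - f_y G_x)` for `G = Φ² k(|f|²) f̄`, with `a = f_x`, `b = f_y`, `c
= f`, `p = Φ`. For `u = c̄a` and `v = c̄b` one has `Im (u Re v - v Re u) = -|c|² Im (āb)`, so the
derivative of the weight contributes with the same sign as the weight itself, which produces the
factor `k + |c|² k'`. -/
lemma jacobian_identity (a b c : ℂ) (p p₁ p₂ k k' : ℝ) :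
    (a * (((2 * p * p₂ * k + p ^ 2 * (k' * (2 * ((starRingEnd ℂ c) * b).re)) : ℝ) : ℂ) *
          starRingEnd ℂ c + ((p ^ 2 * k : ℝ) : ℂ) * starRingEnd ℂ b)
      - b * (((2 * p * p₁ * k + p ^ 2 * (k' * (2 * ((starRingEnd ℂ c) * a).re)) : ℝ) : ℂ) *
          starRingEnd ℂ c + ((p ^ 2 * k : ℝ) : ℂ) * starRingEnd ℂ a)).im
    = 2 * (-(p ^ 2 * (k + ‖c‖ ^ 2 * k') * ((starRingEnd ℂ a) * b).im)
      + p * k * ((starRingEnd ℂ c) * (a * p₂ - b * p₁)).im) := by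
  rw [← Complex.normSq_eq_norm_sq, Complex.normSq_apply]
  simp [pow_two]
  ring

/-- For `a = f_x`, `b = f_y` the left side is `4|∂̄f|²`. Thus a bound on `∂̄f` controls the full
gradient up to the Jacobian `Im (āb)`, whose weighted integral is reduced to cutoff terms. -/
lemma norm_add_I_mul_sq (a b : ℂ) :
    ‖a + Complex.I * b‖ ^ 2 = ‖a‖ ^ 2 + ‖b‖ ^ 2 - 2 * ((starRingEnd ℂ a) * b).im := by
  simp only [← Complex.normSq_eq_norm_sq, Complex.normSq_apply]
  simp
  ring

/-- The identity for `|a + ib|²` is used twice over (`h1` doubled): one copy of the weighted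
gradient is the conclusion, the other absorbs the cutoff term, split by `2xy ≤ x² + y²`. The bracket
multiplied by `-4` is half the Jacobian form of `jacobian_identity` and integrates to zero. -/
lemma caccioppoli_pointwise {a b c : ℂ} {p p₁ p₂ k k' M S B κ : ℝ}
    (hk : 0 ≤ k) (hk1 : k ≤ 1) (hk' : 0 ≤ k') (hκ : k + ‖c‖ ^ 2 * k' ≤ κ) (hp : |p| ≤ 1)
    (hS : ‖c‖ ≤ S) (hB1 : |p₁| ≤ B) (hB2 : |p₂| ≤ B)
    (hM : p ≠ 0 → k + ‖c‖ ^ 2 * k' ≠ 0 → ‖(1 / 2 : ℂ) * (a + Complex.I * b)‖ ≤ M) :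
    p ^ 2 * (k + ‖c‖ ^ 2 * k') * (‖a‖ ^ 2 + ‖b‖ ^ 2) ≤
      -4 * (-(p ^ 2 * (k + ‖c‖ ^ 2 * k') * ((starRingEnd ℂ a) * b).im)
      + p * k * ((starRingEnd ℂ c) * (a * p₂ - b * p₁)).im) + 8 * (M ^ 2 * κ + S ^ 2 * B ^ 2) := by
  set m := k + ‖c‖ ^ 2 * k' with hm
  have hkm : k ≤ m := by have : 0 ≤ ‖c‖ ^ 2 * k' := by positivity
                         linarith
  have hm0 : 0 ≤ m := hk.trans hkm
  have hp1 : p ^ 2 ≤ 1 := by rw [← sq_abs]; nlinarith [abs_nonneg p]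
  have hS0 : 0 ≤ S := (norm_nonneg _).trans hS
  have hB0 : 0 ≤ B := (abs_nonneg _).trans hB1
  -- the Jacobian term
  have h1 : p ^ 2 * m * (‖a‖ ^ 2 + ‖b‖ ^ 2 - 2 * ((starRingEnd ℂ a) * b).im) ≤ 4 * M ^ 2 * κ := by
    rw [← norm_add_I_mul_sq]
    by_cases h0 : p = 0
    · simp [h0]; nlinarith [sq_nonneg M]
    by_cases h00 : m = 0
    · simp [h00]; nlinarith [sq_nonneg M]
    have h := hM h0 h00
    rw [norm_mul] at h
    norm_num at h
    have h2 : ‖a + Complex.I * b‖ ^ 2 ≤ 4 * M ^ 2 := by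
      nlinarith [norm_nonneg (a + Complex.I * b)]
    calc p ^ 2 * m * ‖a + Complex.I * b‖ ^ 2 ≤ 1 * κ * (4 * M ^ 2) := by
          have := hm0.trans hκ
          gcongr
      _ = _ := by ring
  -- the cutoff term
  have h2 : |p * k * ((starRingEnd ℂ c) * (a * p₂ - b * p₁)).im| ≤
      k * (|p| * (S * B * (‖a‖ + ‖b‖))) := by
    rw [abs_mul, abs_mul, abs_of_nonneg hk]
    have : |((starRingEnd ℂ c) * (a * p₂ - b * p₁)).im| ≤ S * B * (‖a‖ + ‖b‖) := by
      refine (Complex.abs_im_le_norm _).trans ?_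
      rw [norm_mul, RCLike.norm_conj]
      have : ‖a * p₂ - b * p₁‖ ≤ B * (‖a‖ + ‖b‖) := by
        refine (norm_sub_le _ _).trans ?_
        simp only [norm_mul, Complex.norm_real, Real.norm_eq_abs]
        nlinarith [mul_le_mul_of_nonneg_left hB2 (norm_nonneg a),
          mul_le_mul_of_nonneg_left hB1 (norm_nonneg b)]
      calc ‖c‖ * ‖a * p₂ - b * p₁‖ ≤ S * (B * (‖a‖ + ‖b‖)) := by gcongr
        _ = _ := by ring
    calc |p| * k * |((starRingEnd ℂ c) * (a * p₂ - b * p₁)).im|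
        ≤ |p| * k * (S * B * (‖a‖ + ‖b‖)) := by gcongr
      _ = _ := by ring
  have h3 : |p| * (S * B * (‖a‖ + ‖b‖)) ≤ p ^ 2 * (‖a‖ ^ 2 + ‖b‖ ^ 2) / 8 + 4 * (S * B) ^ 2 := by
    rw [← sq_abs p]
    nlinarith [sq_nonneg (|p| * ‖a‖ - 4 * (S * B)), sq_nonneg (|p| * ‖b‖ - 4 * (S * B))]
  have h3' : |p| * (S * B * (‖a‖ + ‖b‖)) ≤ p ^ 2 * (‖a‖ ^ 2 + ‖b‖ ^ 2) / 4 + 2 * (S * B) ^ 2 := by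
    rw [← sq_abs p]
    nlinarith [sq_nonneg (|p| * ‖a‖ - 2 * (S * B)), sq_nonneg (|p| * ‖b‖ - 2 * (S * B))]
  have h4 : k * (|p| * (S * B * (‖a‖ + ‖b‖))) ≤
      m * (p ^ 2 * (‖a‖ ^ 2 + ‖b‖ ^ 2) / 4) + 2 * (S * B) ^ 2 := by
    calc k * (|p| * (S * B * (‖a‖ + ‖b‖)))
        ≤ k * (p ^ 2 * (‖a‖ ^ 2 + ‖b‖ ^ 2) / 4 + 2 * (S * B) ^ 2) := by gcongr
      _ = k * (p ^ 2 * (‖a‖ ^ 2 + ‖b‖ ^ 2) / 4) + k * (2 * (S * B) ^ 2) := by ring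
      _ ≤ m * (p ^ 2 * (‖a‖ ^ 2 + ‖b‖ ^ 2) / 4) + 1 * (2 * (S * B) ^ 2) := by gcongr
      _ = _ := by ring
  have h5 := (le_abs_self _).trans (h2.trans h4)
  nlinarith

/-- The Jacobian form of `f` and `Φ² k(|f|²) f̄` integrates to zero. The bound on `∂̄f` is needed
only where the weight is nonzero, and `k` enters the result only through `κ`; hence the estimate is
uniform for cutoffs `k` at all scales. -/
lemma caccioppoli {f : ℂ → ℂ} (hf : ContDiff ℝ ∞ f) {Φ : ℂ → ℝ} (hΦ : ContDiff ℝ ∞ Φ)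
    (hΦc : HasCompactSupport Φ) (hΦ1 : ∀ z, |Φ z| ≤ 1) {k : ℝ → ℝ} (hk : ContDiff ℝ ∞ k)
    (hk0 : ∀ s, 0 ≤ k s) (hk1 : ∀ s, k s ≤ 1) (hk' : ∀ s, 0 ≤ deriv k s) {κ S B M : ℝ}
    (hκ : ∀ s, 0 ≤ s → k s + s * deriv k s ≤ κ) (hB : ∀ z, ‖fderiv ℝ Φ z‖ ≤ B)
    (hS : ∀ z ∈ tsupport Φ, ‖f z‖ ≤ S)
    (hM : ∀ z, Φ z ≠ 0 → k (‖f z‖ ^ 2) + ‖f z‖ ^ 2 * deriv k (‖f z‖ ^ 2) ≠ 0 → ‖dbar f z‖ ≤ M) :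
    ∫ z, Φ z ^ 2 * (k (‖f z‖ ^ 2) + ‖f z‖ ^ 2 * deriv k (‖f z‖ ^ 2)) *
        (‖fderiv ℝ f z 1‖ ^ 2 + ‖fderiv ℝ f z Complex.I‖ ^ 2) ≤
      8 * (M ^ 2 * κ + S ^ 2 * B ^ 2) * volume.real (tsupport Φ) := by
  have hfd (v : ℂ) : Continuous fun z => fderiv ℝ f z v :=
    (hf.continuous_fderiv (by simp)).clm_apply continuous_const
  have hΦd (v : ℂ) : Continuous fun z => fderiv ℝ Φ z v :=
    (hΦ.continuous_fderiv (by simp)).clm_apply continuous_const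
  have hkd : Continuous (deriv k) := hk.continuous_deriv (by simp)
  have hfc := hf.continuous
  have hΦcont := hΦ.continuous
  have hkc := hk.continuous
  set G : ℂ → ℂ := fun z => ((Φ z ^ 2 * k (‖f z‖ ^ 2) : ℝ) : ℂ) * starRingEnd ℂ (f z) with hG
  have hGs : ContDiff ℝ ∞ G := by
    have h1 : ContDiff ℝ ∞ fun z => Φ z ^ 2 * k (‖f z‖ ^ 2) :=
      (hΦ.pow 2).mul (hk.comp (hf.norm_sq ℝ))
    exact (Complex.ofRealCLM.contDiff.comp h1).mul (Complex.conjCLE.contDiff.comp hf)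
  have hGc : HasCompactSupport G := by
    refine hΦc.mono fun z hz => ?_
    contrapose! hz
    simp only [Function.mem_support, not_not] at hz
    simp [hG, hz]
  have hGd (z v : ℂ) : fderiv ℝ G z v =
      ((2 * Φ z * fderiv ℝ Φ z v * k (‖f z‖ ^ 2) + Φ z ^ 2 * (deriv k (‖f z‖ ^ 2) *
        (2 * ((starRingEnd ℂ (f z)) * fderiv ℝ f z v).re)) : ℝ) : ℂ) * starRingEnd ℂ (f z)
      + ((Φ z ^ 2 * k (‖f z‖ ^ 2) : ℝ) : ℂ) * starRingEnd ℂ (fderiv ℝ f z v) := by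
    have d1 := (hf.differentiable (by simp) z).hasFDerivAt
    have d2 := (hΦ.differentiable (by simp) z).hasFDerivAt
    have d3 : HasFDerivAt (fun z => k (‖f z‖ ^ 2)) _ z :=
      ((hk.differentiable (by simp) (‖f z‖ ^ 2)).hasDerivAt).comp_hasFDerivAt z d1.norm_sq
    have d4 := (d2.pow 2).mul d3
    have d5 : HasFDerivAt (fun z => ((Φ z ^ 2 * k (‖f z‖ ^ 2) : ℝ) : ℂ)) _ z :=
      Complex.ofRealCLM.hasFDerivAt.comp z d4
    have d6 : HasFDerivAt (fun z => starRingEnd ℂ (f z)) _ z :=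
      (Complex.conjCLE : ℂ →L[ℝ] ℂ).hasFDerivAt.comp z d1
    have d7 : HasFDerivAt G _ z := d5.mul d6
    rw [d7.fderiv]
    simp [Complex.inner]
    ring
  set E : ℂ → ℝ := fun z => (fderiv ℝ f z 1 * fderiv ℝ G z Complex.I -
    fderiv ℝ f z Complex.I * fderiv ℝ G z 1).im with hE
  have hGd' (v : ℂ) : Continuous fun z => fderiv ℝ G z v :=
    (hGs.continuous_fderiv (by simp)).clm_apply continuous_const
  have hGcc (v : ℂ) : HasCompactSupport fun z => fderiv ℝ G z v := hGc.fderiv_apply ℝ v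
  have i2 (u v : ℂ) : Integrable fun z => fderiv ℝ f z u * fderiv ℝ G z v :=
    ((hfd u).mul (hGd' v)).integrable_of_hasCompactSupport (hGcc v).mul_left
  have hi := (i2 1 Complex.I).sub (i2 Complex.I 1)
  have hE0 : ∫ z, E z = 0 := by
    have h := Complex.imCLM.integral_comp_comm hi
    simp only [Complex.imCLM_apply, Pi.sub_apply] at h
    rw [hE, h, integral_jacobian_eq_zero hf hGs hGc, Complex.zero_im]
  have hEi : Integrable E := by
    have := Complex.imCLM.integrable_comp hi
    exact this
  have hpt : ∀ z, Φ z ^ 2 * (k (‖f z‖ ^ 2) + ‖f z‖ ^ 2 * deriv k (‖f z‖ ^ 2)) *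
        (‖fderiv ℝ f z 1‖ ^ 2 + ‖fderiv ℝ f z Complex.I‖ ^ 2) ≤
      -2 * E z + (tsupport Φ).indicator (fun _ => 8 * (M ^ 2 * κ + S ^ 2 * B ^ 2)) z := by
    intro z
    have e : E z = (fderiv ℝ f z 1 * fderiv ℝ G z Complex.I -
      fderiv ℝ f z Complex.I * fderiv ℝ G z 1).im := rfl
    rw [hGd, hGd, jacobian_identity] at e
    by_cases hz : z ∈ tsupport Φ
    · rw [Set.indicator_of_mem hz, e]
      have b (v : ℂ) (hv : ‖v‖ = 1) : |fderiv ℝ Φ z v| ≤ B := by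
        have := (fderiv ℝ Φ z).le_opNorm v
        rw [hv, mul_one] at this
        exact this.trans (hB z)
      have := caccioppoli_pointwise (a := fderiv ℝ f z 1) (b := fderiv ℝ f z Complex.I) (c := f z)
        (hk0 (‖f z‖ ^ 2)) (hk1 _) (hk' (‖f z‖ ^ 2)) (hκ _ (by positivity)) (hΦ1 z) (hS z hz)
        (b 1 (by simp)) (b Complex.I (by simp)) (hM z)
      linarith
    · have h0 : Φ z = 0 := image_eq_zero_of_notMem_tsupport hz
      rw [Set.indicator_of_notMem hz, e, h0]
      simp
  have hind : Integrable ((tsupport Φ).indicator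
      (fun _ : ℂ => 8 * (M ^ 2 * κ + S ^ 2 * B ^ 2))) :=
    (integrable_indicator_iff (isClosed_tsupport Φ).measurableSet).2
      (integrableOn_const hΦc.isCompact.measure_lt_top.ne)
  refine (integral_mono ?_ ((hEi.const_mul (-2)).add hind) hpt).trans ?_
  · apply Continuous.integrable_of_hasCompactSupport
    · fun_prop
    · refine hΦc.mono fun z hz => ?_
      contrapose! hz
      simp only [Function.mem_support, not_not] at hz
      simp [hz]
  · rw [integral_add' (hEi.const_mul (-2)) hind, integral_const_mul, hE0,
      integral_indicator (isClosed_tsupport Φ).measurableSet, setIntegral_const, smul_eq_mul]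
    linarith

/-! ### Mollification of a weak solution. -/

lemma contDiff_mollify (ρ : ContDiffBump (0 : ℂ)) {V : ℂ → ℂ} (hV : Continuous V) :
    ContDiff ℝ ∞ (ρ.normed volume ⋆[ContinuousLinearMap.lsmul ℝ ℝ, volume] V) :=
  ρ.hasCompactSupport_normed.contDiff_convolution_left _ ρ.contDiff_normed hV.locallyIntegrable

lemma fderiv_mollify (ρ : ContDiffBump (0 : ℂ)) {V : ℂ → ℂ} (hV : Continuous V) (z v : ℂ) :
    fderiv ℝ (ρ.normed volume ⋆[ContinuousLinearMap.lsmul ℝ ℝ, volume] V) z v =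
      ∫ t, (fderiv ℝ (ρ.normed volume) (z - t) v : ℂ) * V t := by
  rw [← convolution_flip]
  have hc : HasCompactSupport (ρ.normed volume) := ρ.hasCompactSupport_normed
  have hρ : ContDiff ℝ 1 (ρ.normed volume) := ρ.contDiff_normed
  have h := hc.hasFDerivAt_convolution_right (μ := volume)
    (ContinuousLinearMap.lsmul ℝ ℝ : ℝ →L[ℝ] ℂ →L[ℝ] ℂ).flip hV.locallyIntegrable hρ z
  rw [h.fderiv, convolution_precompR_apply _ hV.locallyIntegrable
    (hc.fderiv ℝ) (hρ.continuous_fderiv one_ne_zero)]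
  simp [convolution]

/-- The translate `ρ(z - ·)` is an admissible test function when its ball lies in `U`. So `∂̄(ρ *
V)(z)` is an average of `μ` against a probability density. -/
lemma norm_dbar_mollify_le (ρ : ContDiffBump (0 : ℂ)) {U : Set ℂ} {V μ : ℂ → ℂ}
    (hV : Continuous V) (hw : HasWeakDbar U V μ) {M : ℝ} (hM0 : 0 ≤ M)
    (hM : ∀ᵐ z ∂(volume.restrict U), ‖μ z‖ ≤ M) {z : ℂ} (hz : Metric.closedBall z ρ.rOut ⊆ U) :
    ‖dbar (ρ.normed volume ⋆[ContinuousLinearMap.lsmul ℝ ℝ, volume] V) z‖ ≤ M := by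
  set φ : ℂ → ℂ := fun t => (ρ.normed volume (z - t) : ℂ) with hφ
  have hρ : ContDiff ℝ ∞ (ρ.normed volume) := ρ.contDiff_normed
  have hφs : ContDiff ℝ ∞ φ :=
    Complex.ofRealCLM.contDiff.comp (hρ.comp (contDiff_const.sub contDiff_id))
  have hsupp : Function.support φ ⊆ Metric.closedBall z ρ.rOut := by
    intro t ht
    have h1 : z - t ∈ Function.support (ρ.normed volume) := by
      simpa [hφ] using ht
    rw [ρ.support_normed_eq] at h1
    simp only [Metric.mem_ball, dist_zero_right] at h1
    rw [Metric.mem_closedBall, dist_comm, dist_eq_norm]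
    exact h1.le
  have htsupp : tsupport φ ⊆ Metric.closedBall z ρ.rOut :=
    closure_minimal hsupp Metric.isClosed_closedBall
  have hφc : HasCompactSupport φ :=
    (isCompact_closedBall z ρ.rOut).of_isClosed_subset (isClosed_tsupport _) htsupp
  have hφd (t v : ℂ) : fderiv ℝ φ t v = -(fderiv ℝ (ρ.normed volume) (z - t) v : ℂ) := by
    have h1 : HasFDerivAt (fun t : ℂ => z - t) (-ContinuousLinearMap.id ℝ ℂ) t :=
      (hasFDerivAt_id t).const_sub z
    have h2 : HasFDerivAt φ _ t := Complex.ofRealCLM.hasFDerivAt.comp t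
      ((hρ.differentiable (by simp) (z - t)).hasFDerivAt.comp t h1)
    rw [h2.fderiv]
    simp
  have hφi (v : ℂ) : Integrable fun t => fderiv ℝ φ t v * V t := by
    apply Continuous.integrable_of_hasCompactSupport
    · exact ((hφs.continuous_fderiv (by simp)).clm_apply continuous_const).mul hV
    · exact (hφc.fderiv_apply ℝ v).mul_right
  have key : dbar (ρ.normed volume ⋆[ContinuousLinearMap.lsmul ℝ ℝ, volume] V) z =
      - ∫ t, V t * dbar φ t := by
    have e : ∀ t, V t * dbar φ t = (1 / 2 : ℂ) * (fderiv ℝ φ t 1 * V t)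
        + (Complex.I / 2) * (fderiv ℝ φ t Complex.I * V t) := by
      intro t; unfold dbar; ring
    simp_rw [e]
    rw [integral_add ((hφi 1).const_mul _) ((hφi _).const_mul _)]
    simp_rw [integral_const_mul, hφd, neg_mul, integral_neg]
    unfold dbar
    rw [fderiv_mollify ρ hV, fderiv_mollify ρ hV]
    ring
  have hU : ∫ t, V t * dbar φ t = ∫ t in U, V t * dbar φ t := by
    rw [setIntegral_eq_integral_of_forall_compl_eq_zero]
    intro t ht
    have : dbar φ t = 0 := by
      by_contra h
      exact ht (hz (htsupp (support_dbar_subset φ h)))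
    rw [this, mul_zero]
  rw [key, hU, hw φ hφs hφc (htsupp.trans hz), neg_neg]
  have hint : Integrable fun t => M * ρ.normed volume (z - t) :=
    ((ρ.integrable_normed (μ := volume)).comp_sub_left z).const_mul M
  calc ‖∫ t in U, μ t * φ t‖ ≤ ∫ t in U, M * ρ.normed volume (z - t) := by
        refine norm_integral_le_of_norm_le hint.integrableOn ?_
        filter_upwards [hM] with t ht
        rw [norm_mul, hφ]
        simp only [Complex.norm_real, Real.norm_eq_abs, abs_of_nonneg (ρ.nonneg_normed _)]
        exact mul_le_mul_of_nonneg_right ht (ρ.nonneg_normed _)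
    _ ≤ ∫ t, M * ρ.normed volume (z - t) :=
        setIntegral_le_integral hint
          (Eventually.of_forall fun t => mul_nonneg hM0 (ρ.nonneg_normed _))
    _ = M := by
        rw [integral_const_mul, integral_sub_left_eq_self (ρ.normed volume) volume z,
          ρ.integral_normed, mul_one]

/-! ### Cutoffs in `|f|²` at scale `δ`. -/

/-- The first bound is scale invariant: it gives `s k'(s) ≤ σ` for the cutoff `k` at every scale
`δ`. The second serves the logarithmic cutoff near the boundary. -/
lemma exists_bound_mul_deriv_smoothTransition :
    ∃ σ : ℝ, 0 ≤ σ ∧ ∀ t, |t * deriv Real.smoothTransition (t - 1)| ≤ σ ∧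
      |deriv Real.smoothTransition t| ≤ σ := by
  have hd0 : ∀ t : ℝ, t ∉ Set.Icc (0 : ℝ) 1 → deriv Real.smoothTransition t = 0 := by
    intro t ht
    rw [Set.mem_Icc, not_and_or, not_le, not_le] at ht
    rcases ht with ht | ht
    · have : Real.smoothTransition =ᶠ[𝓝 t] fun _ => 0 := by
        filter_upwards [gt_mem_nhds ht] with s hs
        exact Real.smoothTransition.zero_of_nonpos hs.le
      rw [this.deriv_eq]; simp
    · have : Real.smoothTransition =ᶠ[𝓝 t] fun _ => 1 := by
        filter_upwards [lt_mem_nhds ht] with s hs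
        exact Real.smoothTransition.one_of_one_le hs.le
      rw [this.deriv_eq]; simp
  have hc : Continuous (deriv Real.smoothTransition) :=
    (Real.smoothTransition.contDiff (n := 1)).continuous_deriv (by simp)
  obtain ⟨C, hC⟩ := (isCompact_Icc (a := (0:ℝ)) (b := 1)).exists_bound_of_continuousOn hc.continuousOn
  have hC0 : 0 ≤ C := (norm_nonneg _).trans (hC 0 (by simp))
  have hall : ∀ t, |deriv Real.smoothTransition t| ≤ C := by
    intro t
    by_cases ht : t ∈ Set.Icc (0 : ℝ) 1
    · exact hC t ht
    · rw [hd0 t ht]; simpa using hC0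
  refine ⟨2 * C, by positivity, fun t => ⟨?_, (hall t).trans (by linarith)⟩⟩
  by_cases ht : t - 1 ∈ Set.Icc (0 : ℝ) 1
  · rw [abs_mul]
    have : |t| ≤ 2 := by rw [abs_le]; constructor <;> linarith [ht.1, ht.2]
    exact mul_le_mul this (hall _) (abs_nonneg _) (by norm_num)
  · rw [hd0 _ ht]; simpa using hC0

/-- The cutoff `s ↦ S(s/δ² - 1)`, zero for `s ≤ δ²` and one for `s ≥ 2δ²`. -/
noncomputable def sqCutoff (δ : ℝ) (s : ℝ) : ℝ := Real.smoothTransition (s / δ ^ 2 - 1)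

lemma sqCutoff_contDiff (δ : ℝ) : ContDiff ℝ ∞ (sqCutoff δ) :=
  Real.smoothTransition.contDiff.comp ((contDiff_id.div_const _).sub contDiff_const)

lemma deriv_sqCutoff (δ s : ℝ) :
    deriv (sqCutoff δ) s = deriv Real.smoothTransition (s / δ ^ 2 - 1) / δ ^ 2 := by
  have h1 : HasDerivAt (fun s : ℝ => s / δ ^ 2 - 1) (1 / δ ^ 2) s :=
    ((hasDerivAt_id s).div_const _).sub_const _
  have h2 : HasDerivAt (sqCutoff δ) _ s :=
    (((Real.smoothTransition.contDiff (n := 1)).differentiable (by simp) _).hasDerivAt).comp s h1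
  rw [h2.deriv]; ring

lemma deriv_sqCutoff_nonneg (δ s : ℝ) : 0 ≤ deriv (sqCutoff δ) s := by
  rw [deriv_sqCutoff]
  exact div_nonneg Real.smoothTransition.monotone.deriv_nonneg (sq_nonneg _)

lemma sqCutoff_eq_zero {δ s : ℝ} (hδ : 0 < δ) (hs : s ≤ δ ^ 2) : sqCutoff δ s = 0 :=
  Real.smoothTransition.zero_of_nonpos (by
    rw [sub_nonpos]; exact div_le_one_of_le₀ hs (by positivity))

lemma sqCutoff_eq_one {δ s : ℝ} (hδ : 0 < δ) (hs : 2 * δ ^ 2 ≤ s) : sqCutoff δ s = 1 :=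
  Real.smoothTransition.one_of_one_le (by
    have : 2 ≤ s / δ ^ 2 := by rw [le_div_iff₀ (by positivity)]; exact hs
    linarith)

lemma deriv_sqCutoff_eq_zero {δ s : ℝ} (hδ : 0 < δ) (hs : s < δ ^ 2) :
    deriv (sqCutoff δ) s = 0 := by
  have : sqCutoff δ =ᶠ[𝓝 s] fun _ => 0 := by
    filter_upwards [gt_mem_nhds hs] with t ht
    exact sqCutoff_eq_zero hδ ht.le
  rw [this.deriv_eq]; simp

lemma deriv_sqCutoff_eq_zero' {δ s : ℝ} (hδ : 0 < δ) (hs : 2 * δ ^ 2 < s) :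
    deriv (sqCutoff δ) s = 0 := by
  have : sqCutoff δ =ᶠ[𝓝 s] fun _ => 1 := by
    filter_upwards [lt_mem_nhds hs] with t ht
    exact sqCutoff_eq_one hδ ht.le
  rw [this.deriv_eq]; simp

/-- The gradient of `k(|f|²)` in terms of that of `f`. -/
lemma norm_dbar_comp_norm_sq_le {f : ℂ → ℂ} (hf : ContDiff ℝ ∞ f) {k : ℝ → ℝ}
    (hk : ContDiff ℝ ∞ k) (z : ℂ) :
    ‖dbar (fun z => ((k (‖f z‖ ^ 2) : ℝ) : ℂ)) z‖ ≤
      |deriv k (‖f z‖ ^ 2)| * ‖f z‖ * (‖fderiv ℝ f z 1‖ + ‖fderiv ℝ f z Complex.I‖) := by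
  have hd (v : ℂ) : ‖fderiv ℝ (fun z => ((k (‖f z‖ ^ 2) : ℝ) : ℂ)) z v‖ ≤
      |deriv k (‖f z‖ ^ 2)| * (2 * (‖f z‖ * ‖fderiv ℝ f z v‖)) := by
    have d1 := (hf.differentiable (by simp) z).hasFDerivAt
    have d3 : HasFDerivAt (fun z => k (‖f z‖ ^ 2)) _ z :=
      ((hk.differentiable (by simp) (‖f z‖ ^ 2)).hasDerivAt).comp_hasFDerivAt z d1.norm_sq
    have d5 : HasFDerivAt (fun z => ((k (‖f z‖ ^ 2) : ℝ) : ℂ)) _ z :=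
      Complex.ofRealCLM.hasFDerivAt.comp z d3
    rw [d5.fderiv]
    have h := abs_real_inner_le_norm (f z) (fderiv ℝ f z v)
    simp only [ContinuousLinearMap.comp_apply, smul_apply, smul_eq_mul, innerSL_apply_apply,
      Complex.ofRealCLM_apply, Complex.norm_real, Real.norm_eq_abs, abs_mul, nsmul_eq_mul]
    rw [Nat.cast_ofNat, abs_two]
    gcongr
  refine (norm_dbar_le _ _).trans ?_
  have h1 := hd 1
  have h2 := hd Complex.I
  linarith

lemma exists_mollify_close {V : ℂ → ℂ} (hV : Continuous V) {T : Set ℂ} (hT : IsCompact T)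
    {δ : ℝ} (hδ : 0 < δ) :
    ∃ ρ : ContDiffBump (0 : ℂ),
      (∀ z ∈ T, ∀ w ∈ Metric.closedBall z ρ.rOut, ‖V w - V z‖ ≤ δ) ∧
      ∀ z ∈ T, ‖(ρ.normed volume ⋆[ContinuousLinearMap.lsmul ℝ ℝ, volume] V) z - V z‖ ≤ δ := by
  have huc : UniformContinuousOn V (Metric.cthickening 1 T) :=
    (hT.cthickening).uniformContinuousOn_of_continuous hV.continuousOn
  rw [Metric.uniformContinuousOn_iff_le] at huc
  obtain ⟨η, hη, h⟩ := huc δ hδ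
  have hm : 0 < min η 1 := lt_min hη one_pos
  let ρ : ContDiffBump (0 : ℂ) := ⟨min η 1 / 2, min η 1, by positivity, by linarith⟩
  have h1 : ∀ z ∈ T, ∀ w ∈ Metric.closedBall z ρ.rOut, ‖V w - V z‖ ≤ δ := by
    intro z hz w hw
    have hw' : dist w z ≤ min η 1 := hw
    rw [← dist_eq_norm]
    refine h w ?_ z (Metric.self_subset_cthickening T hz) (hw'.trans (min_le_left _ _))
    exact Metric.mem_cthickening_of_dist_le w z 1 T hz (hw'.trans (min_le_right _ _))
  refine ⟨ρ, h1, fun z hz => ?_⟩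
  rw [← dist_eq_norm]
  refine ρ.dist_normed_convolution_le hV.aestronglyMeasurable fun w hw => ?_
  rw [dist_eq_norm]
  exact h1 z hz w (Metric.ball_subset_closedBall hw)

set_option maxHeartbeats 1000000 in
/-- Testing against `φ · k(|f|²)`, where `f` is a mollification of `V`, the error made in replacing
the weak `∂̄`-equation on `U` by the one on the plane. -/
lemma weakDbar_truncation_estimate {U : Set ℂ} (hU : IsOpen U) {V μ ν : ℂ → ℂ}
    (hV : Continuous V) (hV0 : ∀ z ∉ U, V z = 0) (hw : HasWeakDbar U V μ) {M : ℝ} (hM0 : 0 ≤ M)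
    (hM : ∀ᵐ z ∂(volume.restrict U), ‖μ z‖ ≤ M) (hν : Measurable ν) (hνM : ∀ z, ‖ν z‖ ≤ M)
    (hν0 : ∀ z, V z = 0 → ν z = 0) (hνμ : ∀ᵐ z, V z ≠ 0 → ν z = μ z)
    {φ : ℂ → ℂ} (hφ : ContDiff ℝ ∞ φ) (hφc : HasCompactSupport φ) :
    ∃ c : ℝ, 0 ≤ c ∧ ∀ δ τ : ℝ, 0 < δ → δ ≤ 1 → 0 < τ →
      ‖∫ z, (V z * dbar φ z + ν z * φ z)‖ ≤
        c * (δ + τ + (1 + 1 / τ) * volume.real {z ∈ tsupport φ | 0 < ‖V z‖ ∧ ‖V z‖ < 3 * δ}) := by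
  obtain ⟨σ, hσ0, hσ⟩ := exists_bound_mul_deriv_smoothTransition
  obtain ⟨R, hR, hφR⟩ : ∃ R : ℝ, 0 < R ∧ tsupport φ ⊆ Metric.closedBall 0 R := by
    obtain ⟨R, hR⟩ := hφc.isCompact.isBounded.subset_closedBall 0
    exact ⟨max R 1, by positivity, hR.trans (Metric.closedBall_subset_closedBall (le_max_left _ _))⟩
  -- `Φ = 1` on the support of `φ`, so the Caccioppoli inequality for `Φ` bounds the weighted
  -- gradient wherever the test function lives.
  let Φ : ContDiffBump (0 : ℂ) := ⟨R, R + 1, hR, by linarith⟩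
  have hΦs : ContDiff ℝ ∞ Φ := Φ.contDiff
  have hΦc : HasCompactSupport Φ := Φ.hasCompactSupport
  have hΦ1 : ∀ z ∈ tsupport φ, Φ z = 1 := fun z hz => Φ.one_of_mem_closedBall (hφR hz)
  have hΦT : tsupport φ ⊆ tsupport Φ := fun z hz => subset_tsupport _ (by
    rw [Function.mem_support, hΦ1 z hz]; exact one_ne_zero)
  obtain ⟨B, hB⟩ := (hΦc.fderiv ℝ).exists_bound_of_continuous (hΦs.continuous_fderiv (by simp))
  obtain ⟨b, hb⟩ := hφc.exists_bound_of_continuous hφ.continuous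
  obtain ⟨b', hb'⟩ := (hasCompactSupport_dbar hφc).exists_bound_of_continuous (continuous_dbar hφ)
  obtain ⟨S, hS⟩ := hΦc.isCompact.exists_bound_of_continuousOn hV.continuousOn
  have hb0 : 0 ≤ b := (norm_nonneg _).trans (hb 0)
  have hb'0 : 0 ≤ b' := (norm_nonneg _).trans (hb' 0)
  set T := tsupport φ with hT
  have hTm : MeasurableSet T := (isClosed_tsupport φ).measurableSet
  have hTf : volume T ≠ ⊤ := hφc.isCompact.measure_lt_top.ne
  set CC : ℝ := 8 * (M ^ 2 * (1 + σ) + (S + 1) ^ 2 * B ^ 2) * volume.real (tsupport Φ) with hCC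
  have hCC0 : 0 ≤ CC := by positivity
  -- The summands pay, in this order, for `V ∂̄φ` where `|V| < 3δ`, for `νφ` on the layer, and for
  -- the two halves of the arithmetic–geometric splitting of `V φ ∂̄k(|f|²)`.
  refine ⟨3 * b' * volume.real T + M * b + 2 * b * CC + b * σ, by positivity, ?_⟩
  intro δ τ hδ hδ1 hτ
  -- With tolerance `δ/4`, `|f| ≥ δ` forces `|V| ≥ 3δ/4` at the centre and hence `V ≠ 0` on the
  -- whole mollification ball, which therefore lies in `U`. Conversely `|V| ≥ 3δ` forces `|f| ≥ 2δ`,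
  -- where the cutoff equals 1.
  obtain ⟨ρ, hρ1, hρ2⟩ := exists_mollify_close hV hΦc.isCompact (show 0 < δ / 4 by positivity)
  set f := ρ.normed volume ⋆[ContinuousLinearMap.lsmul ℝ ℝ, volume] V with hf
  have hfs : ContDiff ℝ ∞ f := contDiff_mollify ρ hV
  set k := sqCutoff δ with hk
  have hks : ContDiff ℝ ∞ k := sqCutoff_contDiff δ
  have hk0 : ∀ s, 0 ≤ k s := fun s => Real.smoothTransition.nonneg _
  have hk1 : ∀ s, k s ≤ 1 := fun s => Real.smoothTransition.le_one _
  have hk'0 : ∀ s, 0 ≤ deriv k s := deriv_sqCutoff_nonneg δ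
  have hsk : ∀ s, s * deriv k s ≤ σ := by
    intro s
    have h := (le_abs_self _).trans (hσ (s / δ ^ 2)).1
    rw [hk, deriv_sqCutoff]
    calc _ = s / δ ^ 2 * deriv Real.smoothTransition (s / δ ^ 2 - 1) := by ring
      _ ≤ σ := h
  have hfV : ∀ z ∈ tsupport Φ, ‖f z‖ ≤ ‖V z‖ + δ / 4 := by
    intro z hz
    have h1 := hρ2 z hz
    have h2 := norm_sub_norm_le (f z) (V z)
    linarith
  have hVf : ∀ z ∈ tsupport Φ, ‖V z‖ ≤ ‖f z‖ + δ / 4 := by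
    intro z hz
    have h1 := hρ2 z hz
    have h2 := norm_sub_norm_le (V z) (f z)
    rw [norm_sub_rev] at h2
    linarith
  have hlarge : ∀ z ∈ tsupport Φ, δ ≤ ‖f z‖ → Metric.closedBall z ρ.rOut ⊆ U := by
    intro z hz hfz w hw'
    by_contra hwU
    have h1 := hρ1 z hz w hw'
    rw [hV0 w hwU, zero_sub, norm_neg] at h1
    linarith [hfV z hz]
  have hlt : ∀ z, ‖f z‖ < δ → ‖f z‖ ^ 2 < δ ^ 2 := fun z h =>
    pow_lt_pow_left₀ h (norm_nonneg _) two_ne_zero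
  have hkz : ∀ z, ‖f z‖ < δ → k (‖f z‖ ^ 2) = 0 := fun z h => sqCutoff_eq_zero hδ (hlt z h).le
  have hkz' : ∀ z, ‖f z‖ < δ → deriv k (‖f z‖ ^ 2) = 0 := fun z h =>
    deriv_sqCutoff_eq_zero hδ (hlt z h)
  have hdbar : ∀ z, Φ z ≠ 0 → k (‖f z‖ ^ 2) + ‖f z‖ ^ 2 * deriv k (‖f z‖ ^ 2) ≠ 0 →
      ‖dbar f z‖ ≤ M := by
    intro z hz hne
    refine norm_dbar_mollify_le ρ hV hw hM0 hM (hlarge z (subset_tsupport _ hz) ?_)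
    by_contra! hlt'
    apply hne
    rw [hkz z hlt', hkz' z hlt']
    ring
  have hcacc := caccioppoli hfs hΦs hΦc (fun z => by
      rw [abs_of_nonneg Φ.nonneg]; exact Φ.le_one) hks hk0 hk1 hk'0 (κ := 1 + σ) (S := S + 1) (B := B)
    (M := M) (fun s _ => add_le_add (hk1 s) (hsk s)) hB
    (fun z hz => (hfV z hz).trans (by linarith [hS z hz])) hdbar
  rw [← hCC] at hcacc
  set P : ℂ → ℝ := fun z => Φ z ^ 2 * (k (‖f z‖ ^ 2) + ‖f z‖ ^ 2 * deriv k (‖f z‖ ^ 2)) *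
        (‖fderiv ℝ f z 1‖ ^ 2 + ‖fderiv ℝ f z Complex.I‖ ^ 2) with hP
  have hfd (v : ℂ) : Continuous fun z => fderiv ℝ f z v :=
    (hfs.continuous_fderiv (by simp)).clm_apply continuous_const
  have hfc := hfs.continuous
  have hkc := hks.continuous
  have hkd : Continuous (deriv k) := hks.continuous_deriv (by simp)
  have hPi : Integrable P := by
    have := hΦs.continuous
    apply Continuous.integrable_of_hasCompactSupport
    · fun_prop
    · refine hΦc.mono fun z hz => ?_
      contrapose! hz
      simp only [Function.mem_support, not_not] at hz
      simp [hP, hz]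
  have hP0 : ∀ z, 0 ≤ P z := fun z => by
    have := hk0 (‖f z‖ ^ 2); have := hk'0 (‖f z‖ ^ 2); positivity
  -- the test function
  set kk : ℂ → ℂ := fun z => ((k (‖f z‖ ^ 2) : ℝ) : ℂ) with hkk
  have hkks : ContDiff ℝ ∞ kk := Complex.ofRealCLM.contDiff.comp (hks.comp (hfs.norm_sq ℝ))
  set g : ℂ → ℂ := fun z => φ z * kk z with hg
  have hgs : ContDiff ℝ ∞ g := hφ.mul hkks
  have hgc : HasCompactSupport g := hφc.mul_right
  have hgsupp : tsupport g ⊆ U := by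
    have h1 : tsupport g ⊆ T ∩ {z | δ ≤ ‖f z‖} := by
      refine closure_minimal (fun z hz => ⟨?_, ?_⟩)
        ((isClosed_tsupport φ).inter (isClosed_le continuous_const hfc.norm))
      · exact subset_tsupport _ (left_ne_zero_of_mul hz)
      · have := right_ne_zero_of_mul hz
        simp only [Set.mem_ofPred_eq]
        by_contra! hlt'
        apply this
        simp only [hkk]
        rw [hkz z hlt', Complex.ofReal_zero]
    intro z hz
    obtain ⟨hz1, hz2⟩ := h1 hz
    exact hlarge z (hΦT hz1) hz2 (Metric.mem_closedBall_self ρ.rOut_pos.le)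
  have hdg : ∀ z, dbar g z = dbar φ z * kk z + φ z * dbar kk z := fun z =>
    dbar_mul (hφ.differentiable (by simp) z) (hkks.differentiable (by simp) z)
  have hVkk : ∀ z ∈ T, kk z ≠ 0 → V z ≠ 0 := by
    intro z hz hne h0
    apply hne
    have : ‖f z‖ < δ := by
      have := hfV z (hΦT hz); rw [h0, norm_zero] at this; linarith
    simp only [hkk]
    rw [hkz z this, Complex.ofReal_zero]
  have hweak := hw g hgs hgc hgsupp
  have hleft : ∫ z in U, V z * dbar g z = ∫ z, V z * dbar g z :=
    setIntegral_eq_integral_of_forall_compl_eq_zero fun z hz => by rw [hV0 z hz, zero_mul]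
  have hright : ∫ z in U, μ z * g z = ∫ z, ν z * g z := by
    refine Eq.trans ?_ (setIntegral_eq_integral_of_forall_compl_eq_zero (s := U)
      (fun z hz => by rw [hν0 z (hV0 z hz), zero_mul]))
    refine setIntegral_congr_ae hU.measurableSet ?_
    filter_upwards [hνμ] with z hz _
    by_cases h0 : g z = 0
    · rw [h0, mul_zero, mul_zero]
    · rw [hz (hVkk z (subset_tsupport _ (left_ne_zero_of_mul h0)) (right_ne_zero_of_mul h0))]
  rw [hleft, hright] at hweak
  have hνi : ∀ h : ℂ → ℂ, Continuous h → HasCompactSupport h → Integrable fun z => ν z * h z := by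
    intro h hh hhc
    exact (hh.integrable_of_hasCompactSupport hhc).bdd_mul hν.aestronglyMeasurable
      (Eventually.of_forall hνM)
  have hi1 : Integrable fun z => V z * dbar φ z :=
    (hV.mul (continuous_dbar hφ)).integrable_of_hasCompactSupport (hasCompactSupport_dbar hφc).mul_left
  have hi2 : Integrable fun z => V z * dbar g z :=
    (hV.mul (continuous_dbar hgs)).integrable_of_hasCompactSupport (hasCompactSupport_dbar hgc).mul_left
  -- The equation on `U` makes the integral with `g` in place of `φ` vanish, so subtracting it
  -- leaves only the contribution of `1 - k` and of `∂̄k`.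
  have hkey : ∫ z, (V z * dbar φ z + ν z * φ z) =
      ∫ z, ((V z * dbar φ z + ν z * φ z) - (V z * dbar g z + ν z * g z)) := by
    have e1 : ∫ z, (V z * dbar g z + ν z * g z) = 0 := by
      rw [integral_add hi2 (hνi g hgs.continuous hgc), hweak, neg_add_cancel]
    have e2 := integral_sub (f := fun z => V z * dbar φ z + ν z * φ z)
      (g := fun z => V z * dbar g z + ν z * g z)
      (hi1.add (hνi φ hφ.continuous hφc)) (hi2.add (hνi g hgs.continuous hgc))
    rw [e2, e1, sub_zero]
  rw [hkey]
  set E : Set ℂ := {z ∈ T | 0 < ‖V z‖ ∧ ‖V z‖ < 3 * δ} with hE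
  have hEm : MeasurableSet E :=
    hTm.inter ((measurableSet_lt measurable_const hV.norm.measurable).inter
      (measurableSet_lt hV.norm.measurable measurable_const))
  have hEf : volume E ≠ ⊤ := ((measure_mono fun z hz => hz.1).trans_lt hφc.isCompact.measure_lt_top).ne
  have hconst (A : Set ℂ) (hA : MeasurableSet A) (hAf : volume A ≠ ⊤) (c : ℝ) :
      Integrable (A.indicator fun _ : ℂ => c) :=
    (integrable_indicator_iff hA).2 (integrableOn_const hAf)
  have hbound : ∀ z, ‖(V z * dbar φ z + ν z * φ z) - (V z * dbar g z + ν z * g z)‖ ≤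
      T.indicator (fun _ => 3 * δ * b') z + E.indicator (fun _ => M * b + b * σ / τ) z +
        2 * b * τ * P z := by
    intro z
    by_cases hzT : z ∈ T
    swap
    · have h1 : φ z = 0 := image_eq_zero_of_notMem_tsupport hzT
      have h2 : dbar φ z = 0 := by
        by_contra h; exact hzT (support_dbar_subset φ h)
      have h3 : g z = 0 := by simp only [hg]; rw [h1, zero_mul]
      rw [hdg, h3, h1, h2, Set.indicator_of_notMem hzT, Set.indicator_of_notMem fun h => hzT h.1]
      have := hP0 z
      simp only [mul_zero, zero_mul, add_zero, sub_zero, norm_zero, zero_add]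
      positivity
    rw [Set.indicator_of_mem hzT]
    have hPz := hP0 z
    have hE0 : 0 ≤ E.indicator (fun _ => M * b + b * σ / τ) z :=
      Set.indicator_nonneg (fun _ _ => by positivity) z
    have hkz0 := hk0 (‖f z‖ ^ 2)
    have hkz1 := hk1 (‖f z‖ ^ 2)
    have hk'z := hk'0 (‖f z‖ ^ 2)
    have h1 : (V z * dbar φ z + ν z * φ z) - (V z * dbar g z + ν z * g z) =
        ((1 - k (‖f z‖ ^ 2) : ℝ) : ℂ) * (V z * dbar φ z + ν z * φ z) - V z * φ z * dbar kk z := by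
      rw [hdg]; simp only [hg, hkk]; push_cast; ring
    have h1k : ‖((1 - k (‖f z‖ ^ 2) : ℝ) : ℂ)‖ ≤ 1 := by
      rw [Complex.norm_real, Real.norm_eq_abs, abs_le]; constructor <;> linarith
    have hdk := norm_dbar_comp_norm_sq_le hfs hks z
    rw [abs_of_nonneg hk'z] at hdk
    set a := ‖fderiv ℝ f z 1‖ with ha
    set a' := ‖fderiv ℝ f z Complex.I‖ with ha'
    have hPz' : P z = (k (‖f z‖ ^ 2) + ‖f z‖ ^ 2 * deriv k (‖f z‖ ^ 2)) * (a ^ 2 + a' ^ 2) := by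
      simp only [hP]; rw [hΦ1 z hzT]; ring
    rw [h1]
    by_cases hV00 : V z = 0
    · rw [hV00, hν0 z hV00]
      simp only [zero_mul, add_zero, mul_zero, sub_zero, norm_zero]
      positivity
    by_cases hVE : ‖V z‖ < 3 * δ
    · have hzE : z ∈ E := ⟨hzT, norm_pos_iff.2 hV00, hVE⟩
      rw [Set.indicator_of_mem hzE]
      have t1 : ‖((1 - k (‖f z‖ ^ 2) : ℝ) : ℂ) * (V z * dbar φ z + ν z * φ z)‖ ≤
          3 * δ * b' + M * b := by
        rw [norm_mul]
        calc _ ≤ 1 * (‖V z * dbar φ z‖ + ‖ν z * φ z‖) := by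
              gcongr; exact norm_add_le _ _
          _ ≤ _ := by
              rw [norm_mul, norm_mul, one_mul]
              gcongr
              · exact hb' z
              · exact hνM z
              · exact hb z
      have t2 : ‖V z * φ z * dbar kk z‖ ≤ b * σ / τ + 2 * b * τ * P z := by
        by_cases hsmall : ‖f z‖ < δ
        · have : dbar kk z = 0 := by
            rw [deriv_sqCutoff_eq_zero hδ (hlt z hsmall)] at hdk
            simpa using hdk
          rw [this, mul_zero, norm_zero]
          positivity
        push Not at hsmall
        have hV2 : ‖V z‖ ≤ 2 * ‖f z‖ := by linarith [hVf z (hΦT hzT)]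
        have hskz := hsk (‖f z‖ ^ 2)
        set m := ‖f z‖ ^ 2 * deriv k (‖f z‖ ^ 2) with hm
        have hm0 : 0 ≤ m := by positivity
        have ha0 : 0 ≤ a := norm_nonneg _
        have ha'0 : 0 ≤ a' := norm_nonneg _
        calc ‖V z * φ z * dbar kk z‖ ≤ (2 * ‖f z‖) * b *
              (deriv k (‖f z‖ ^ 2) * ‖f z‖ * (a + a')) := by
              rw [norm_mul, norm_mul]
              gcongr
              exact hb z
          _ = 2 * b * (m * (a + a')) := by rw [hm]; ring
          _ ≤ 2 * b * (m * (τ * (a ^ 2 + a' ^ 2) + 1 / (2 * τ))) := by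
              -- The quadratic part goes to the Caccioppoli bound with small factor `τ`. The
              -- constant part costs `1/τ` but is integrated only over the layer `E`.
              have : a + a' ≤ τ * (a ^ 2 + a' ^ 2) + 1 / (2 * τ) := by
                have e : τ * (a ^ 2 + a' ^ 2) + 1 / (2 * τ) - (a + a') =
                  τ * ((a - 1 / (2 * τ)) ^ 2 + (a' - 1 / (2 * τ)) ^ 2) := by field_simp; ring
                have : 0 ≤ τ * ((a - 1 / (2 * τ)) ^ 2 + (a' - 1 / (2 * τ)) ^ 2) := by positivity
                linarith
              gcongr
          _ = 2 * b * τ * (m * (a ^ 2 + a' ^ 2)) + b * m / τ := by field_simp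
          _ ≤ 2 * b * τ * P z + b * σ / τ := by
              rw [hPz']
              have : m ≤ k (‖f z‖ ^ 2) + m := by linarith
              gcongr
          _ = _ := by ring
      calc _ ≤ _ := norm_sub_le _ _
        _ ≤ (3 * δ * b' + M * b) + (b * σ / τ + 2 * b * τ * P z) := add_le_add t1 t2
        _ = _ := by ring
    · push Not at hVE
      have hf2 : 2 * δ ≤ ‖f z‖ := by linarith [hVf z (hΦT hzT)]
      have hf3 : 2 * δ ^ 2 < ‖f z‖ ^ 2 := by nlinarith
      have e1 : dbar kk z = 0 := by
        rw [deriv_sqCutoff_eq_zero' hδ hf3] at hdk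
        simpa using hdk
      rw [e1, show k (‖f z‖ ^ 2) = 1 from sqCutoff_eq_one hδ hf3.le]
      simp only [sub_self, Complex.ofReal_zero, zero_mul, mul_zero, norm_zero]
      positivity
  have hiTE := (hconst T hTm hTf (3 * δ * b')).add (hconst E hEm hEf (M * b + b * σ / τ))
  refine (norm_integral_le_of_norm_le (hiTE.add (hPi.const_mul (2 * b * τ)))
    (Eventually.of_forall hbound)).trans ?_
  have hsum : ∫ z, (T.indicator (fun _ => 3 * δ * b') + E.indicator (fun _ => M * b + b * σ / τ) +
      fun z => 2 * b * τ * P z) z =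
      volume.real T * (3 * δ * b') + volume.real E * (M * b + b * σ / τ) +
        2 * b * τ * ∫ z, P z := by
    rw [integral_add' hiTE (hPi.const_mul _),
      integral_add' (hconst T hTm hTf _) (hconst E hEm hEf _), integral_const_mul,
      integral_indicator hTm, integral_indicator hEm, setIntegral_const, setIntegral_const,
      smul_eq_mul, smul_eq_mul]
  rw [hsum]
  have hT0 : 0 ≤ volume.real T := measureReal_nonneg
  have hE0 : 0 ≤ volume.real E := measureReal_nonneg
  set tT := volume.real T
  set tE := volume.real E
  have q1 : 2 * b * τ * ∫ z, P z ≤ 2 * b * τ * CC := by gcongr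
  have q2 : (3 * b' * tT + M * b + 2 * b * CC + b * σ) * (δ + τ + (1 + 1 / τ) * tE) =
      tT * (3 * δ * b') + (M * b) * tE + (b * σ / τ) * tE + 2 * b * CC * τ +
      (3 * b' * tT * (τ + (1 + 1 / τ) * tE) + M * b * (δ + τ + 1 / τ * tE) +
        2 * b * CC * (δ + (1 + 1 / τ) * tE) + b * σ * (δ + τ + tE)) := by
    ring
  rw [q2]
  have q3 : 0 ≤ 3 * b' * tT * (τ + (1 + 1 / τ) * tE) + M * b * (δ + τ + 1 / τ * tE) +
        2 * b * CC * (δ + (1 + 1 / τ) * tE) + b * σ * (δ + τ + tE) := by positivity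
  have q4 : tE * (M * b + b * σ / τ) = (M * b) * tE + (b * σ / τ) * tE := by ring
  linarith

/-- The sets decrease to the empty set because zeros of `V` are excluded; the zero set itself may
have positive measure. -/
lemma tendsto_measureReal_small_values {V : ℂ → ℂ} (hV : Continuous V) {T : Set ℂ}
    (hT : IsCompact T) :
    Tendsto (fun δ : ℝ => volume.real {z ∈ T | 0 < ‖V z‖ ∧ ‖V z‖ < 3 * δ}) (𝓝[>] 0) (𝓝 0) := by
  have hm (δ : ℝ) : MeasurableSet {z ∈ T | 0 < ‖V z‖ ∧ ‖V z‖ < 3 * δ} :=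
    hT.measurableSet.inter ((measurableSet_lt measurable_const hV.norm.measurable).inter
      (measurableSet_lt hV.norm.measurable measurable_const))
  have h := tendsto_measure_biInter_gt (μ := volume) (a := (0 : ℝ))
    (s := fun δ : ℝ => {z ∈ T | 0 < ‖V z‖ ∧ ‖V z‖ < 3 * δ})
    (fun δ _ => (hm δ).nullMeasurableSet)
    (fun i j _ hij z hz => ⟨hz.1, hz.2.1, hz.2.2.trans_le (by linarith)⟩)
    ⟨1, one_pos, ((measure_mono fun z hz => hz.1).trans_lt hT.measure_lt_top).ne⟩
  have he : (⋂ r > (0 : ℝ), {z ∈ T | 0 < ‖V z‖ ∧ ‖V z‖ < 3 * r}) = ∅ := by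
    rw [Set.eq_empty_iff_forall_notMem]
    intro z hz
    simp only [Set.mem_iInter] at hz
    have h1 := (hz 1 one_pos).2.1
    have h2 := (hz (‖V z‖ / 3) (by simpa using h1)).2.2
    linarith
  rw [he, measure_empty] at h
  exact (ENNReal.tendsto_toReal ENNReal.zero_ne_top).comp h

/-- A continuous function vanishing off an open set `U` with bounded weak `∂̄`-derivative on `U` has
a weak `∂̄`-derivative on the whole plane, with the same bound. -/
theorem exists_hasWeakDbar_univ {U : Set ℂ} (hU : IsOpen U) {V μ : ℂ → ℂ}
    (hV : Continuous V) (hV0 : ∀ z ∉ U, V z = 0) (hw : HasWeakDbar U V μ) {M : ℝ} (hM0 : 0 ≤ M)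
    (hμ : AEStronglyMeasurable μ (volume.restrict U))
    (hM : ∀ᵐ z ∂(volume.restrict U), ‖μ z‖ ≤ M) :
    ∃ ν : ℂ → ℂ, Measurable ν ∧ (∀ z, ‖ν z‖ ≤ M) ∧ HasWeakDbar Set.univ V ν := by
  -- The global derivative is declared zero where `V = 0`. Then no error arises on the zero set, and
  -- the bound by `M` holds at every point.
  set A : Set ℂ := {z | V z ≠ 0 ∧ ‖hμ.mk μ z‖ ≤ M} with hA
  have hmk : Measurable (hμ.mk μ) := hμ.stronglyMeasurable_mk.measurable
  have hAm : MeasurableSet A :=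
    (hV.measurable (measurableSet_singleton 0)).compl.inter
      (measurableSet_le hmk.norm measurable_const)
  set ν : ℂ → ℂ := A.indicator (hμ.mk μ) with hν
  have hνm : Measurable ν := hmk.indicator hAm
  have hνM : ∀ z, ‖ν z‖ ≤ M := by
    intro z
    by_cases hz : z ∈ A
    · rw [hν, Set.indicator_of_mem hz]; exact hz.2
    · rw [hν, Set.indicator_of_notMem hz, norm_zero]; exact hM0
  have hν0 : ∀ z, V z = 0 → ν z = 0 := fun z hz =>
    Set.indicator_of_notMem (fun h => h.1 hz) _
  have hνμ : ∀ᵐ z, V z ≠ 0 → ν z = μ z := by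
    have h1 := (ae_restrict_iff' hU.measurableSet).1 hμ.ae_eq_mk
    have h2 := (ae_restrict_iff' hU.measurableSet).1 hM
    filter_upwards [h1, h2] with z hz1 hz2 hVz
    have hzU : z ∈ U := by
      by_contra h; exact hVz (hV0 z h)
    have hzA : z ∈ A := ⟨hVz, by rw [← hz1 hzU]; exact hz2 hzU⟩
    rw [hν, Set.indicator_of_mem hzA, hz1 hzU]
  refine ⟨ν, hνm, hνM, fun φ hφ hφc _ => ?_⟩
  rw [Measure.restrict_univ]
  obtain ⟨c, hc0, hc⟩ := weakDbar_truncation_estimate hU hV hV0 hw hM0 hM hνm hνM hν0 hνμ hφ hφc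
  have hα := tendsto_measureReal_small_values hV hφc.isCompact
  have hi1 : Integrable fun z => V z * dbar φ z :=
    (hV.mul (continuous_dbar hφ)).integrable_of_hasCompactSupport (hasCompactSupport_dbar hφc).mul_left
  have hi2 : Integrable fun z => ν z * φ z :=
    (hφ.continuous.integrable_of_hasCompactSupport hφc).bdd_mul hνm.aestronglyMeasurable
      (Eventually.of_forall hνM)
  -- Order of limits: `δ → 0` at fixed `τ` removes the layer in spite of the factor `1/τ`, and then
  -- `τ → 0`.
  have hτ : ∀ τ : ℝ, 0 < τ → ‖∫ z, (V z * dbar φ z + ν z * φ z)‖ ≤ c * τ := by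
    intro τ hτ
    have hid : Tendsto (fun δ : ℝ => δ) (𝓝[>] 0) (𝓝 0) := tendsto_nhdsWithin_of_tendsto_nhds tendsto_id
    have hlim := ((hid.add_const τ).add (hα.const_mul (1 + 1 / τ))).const_mul c
    rw [mul_zero, add_zero, zero_add] at hlim
    refine ge_of_tendsto hlim ?_
    filter_upwards [self_mem_nhdsWithin, mem_nhdsWithin_of_mem_nhds (gt_mem_nhds one_pos)]
      with δ hδ hδ1
    exact hc δ τ hδ (le_of_lt hδ1) hτ
  have h0 : ‖∫ z, (V z * dbar φ z + ν z * φ z)‖ ≤ 0 := by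
    have hlim : Tendsto (fun τ : ℝ => c * τ) (𝓝[>] 0) (𝓝 (c * 0)) :=
      (tendsto_nhdsWithin_of_tendsto_nhds tendsto_id).const_mul c
    rw [mul_zero] at hlim
    refine ge_of_tendsto hlim ?_
    filter_upwards [self_mem_nhdsWithin] with τ h
    exact hτ τ h
  rw [norm_le_zero_iff, integral_add hi1 hi2] at h0
  exact eq_neg_of_add_eq_zero_left h0

/-! ### Integrals of radial kernels and of the three-pole kernel. -/

/-- The total mass of the kernel `(1 + |z|²)⁻²`, the `∂̄`-derivative of `z̄ / (1 + |z|²)`. -/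
noncomputable def cauchyConst : ℝ := ∫ z : ℂ, ((1 + ‖z‖ ^ 2) ^ 2)⁻¹

lemma integrable_cauchyConst : Integrable fun z : ℂ => ((1 + ‖z‖ ^ 2) ^ 2)⁻¹ := by
  have h := integrable_rpow_neg_one_add_norm_sq (μ := (volume : Measure ℂ)) (r := 4)
    (by rw [Complex.finrank_real_complex]; norm_num)
  refine h.congr (Eventually.of_forall fun z => ?_)
  simp only
  rw [show (-4 / 2 : ℝ) = -(2 : ℕ) by norm_num, Real.rpow_neg (by positivity), Real.rpow_natCast]

lemma cauchyConst_pos : 0 < cauchyConst := by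
  unfold cauchyConst
  refine (integral_pos_iff_support_of_nonneg (fun z => by positivity) integrable_cauchyConst).2 ?_
  have : (Function.support fun z : ℂ => ((1 + ‖z‖ ^ 2) ^ 2)⁻¹) = Set.univ := by
    ext z
    simp only [Function.mem_support, Set.mem_univ, iff_true]
    positivity
  rw [this]
  simp

/-- Integrals of radial functions on the plane. -/
lemma integral_radial (f : ℝ → ℝ) (p : ℂ) :
    ∫ z : ℂ, f ‖z - p‖ = 2 * volume.real (Metric.ball (0 : ℂ) 1) * ∫ y in Set.Ioi (0 : ℝ), y * f y := by
  rw [integral_sub_right_eq_self (fun z => f ‖z‖) p, integral_fun_norm_addHaar]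
  simp [mul_assoc]

lemma integrable_radial {f : ℝ → ℝ} (p : ℂ)
    (hf : IntegrableOn (fun y => y * f y) (Set.Ioi (0 : ℝ))) :
    Integrable fun z : ℂ => f ‖z - p‖ := by
  have := (integrable_fun_norm_addHaar (volume : Measure ℂ) (f := f)).2 (by simpa using hf)
  exact this.comp_sub_right p

/-- `y⁻¹` cut off at radius `r`. -/
noncomputable def nearKernel (r y : ℝ) : ℝ := (Set.Iio r).indicator (fun y => y⁻¹) y

/-- `y⁻²` restricted to the annulus `r ≤ y ≤ s`. -/
noncomputable def annulusKernel (r s y : ℝ) : ℝ := (Set.Icc r s).indicator (fun y => (y ^ 2)⁻¹) y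

/-- `y⁻³` restricted to `y > s`. -/
noncomputable def farKernel (s y : ℝ) : ℝ := (Set.Ioi s).indicator (fun y => (y ^ 3)⁻¹) y

lemma nearKernel_aux (r : ℝ) : ∀ y ∈ Set.Ioi (0 : ℝ),
    y * nearKernel r y = (Set.Iio r).indicator (fun _ => (1 : ℝ)) y := by
  intro y (hy : 0 < y)
  unfold nearKernel
  by_cases h : y ∈ Set.Iio r
  · rw [Set.indicator_of_mem h, Set.indicator_of_mem h, mul_inv_cancel₀ hy.ne']
  · rw [Set.indicator_of_notMem h, Set.indicator_of_notMem h, mul_zero]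

lemma annulusKernel_aux (r s : ℝ) : ∀ y ∈ Set.Ioi (0 : ℝ),
    y * annulusKernel r s y = (Set.Icc r s).indicator (fun y => y⁻¹) y := by
  intro y (hy : 0 < y)
  unfold annulusKernel
  by_cases h : y ∈ Set.Icc r s
  · rw [Set.indicator_of_mem h, Set.indicator_of_mem h]; field_simp
  · rw [Set.indicator_of_notMem h, Set.indicator_of_notMem h, mul_zero]

lemma farKernel_aux (s : ℝ) : ∀ y ∈ Set.Ioi (0 : ℝ),
    y * farKernel s y = (Set.Ioi s).indicator (fun y => y ^ (-2 : ℝ)) y := by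
  intro y (hy : 0 < y)
  unfold farKernel
  by_cases h : y ∈ Set.Ioi s
  · rw [Set.indicator_of_mem h, Set.indicator_of_mem h,
      show (-2 : ℝ) = -(2 : ℕ) by norm_num, Real.rpow_neg hy.le, Real.rpow_natCast]
    field_simp
  · rw [Set.indicator_of_notMem h, Set.indicator_of_notMem h, mul_zero]

lemma integrable_nearKernel (r : ℝ) (p : ℂ) : Integrable fun z : ℂ => nearKernel r ‖z - p‖ := by
  refine integrable_radial p ?_
  rw [integrableOn_congr_fun (nearKernel_aux r) measurableSet_Ioi]
  have : IntegrableOn (fun _ : ℝ => (1 : ℝ)) (Set.Iio r ∩ Set.Ioi 0) :=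
    integrableOn_const (by rw [Set.inter_comm, Set.Ioi_inter_Iio]; simp)
  rw [IntegrableOn, integrable_indicator_iff measurableSet_Iio, IntegrableOn,
    Measure.restrict_restrict measurableSet_Iio]
  exact this

lemma integral_nearKernel {r : ℝ} (hr : 0 ≤ r) (p : ℂ) :
    ∫ z : ℂ, nearKernel r ‖z - p‖ = 2 * volume.real (Metric.ball (0 : ℂ) 1) * r := by
  rw [integral_radial, setIntegral_congr_fun measurableSet_Ioi (nearKernel_aux r),
    setIntegral_indicator measurableSet_Iio, Set.Ioi_inter_Iio, setIntegral_const]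
  simp [hr]

lemma integrable_annulusKernel {r : ℝ} (hr : 0 < r) (s : ℝ) (p : ℂ) :
    Integrable fun z : ℂ => annulusKernel r s ‖z - p‖ := by
  refine integrable_radial p ?_
  rw [integrableOn_congr_fun (annulusKernel_aux r s) measurableSet_Ioi]
  have h : IntegrableOn (fun y : ℝ => y⁻¹) (Set.Icc r s) :=
    (continuousOn_inv₀.mono fun y hy => (hr.trans_le hy.1).ne').integrableOn_compact isCompact_Icc
  exact ((integrable_indicator_iff measurableSet_Icc).2 h).integrableOn

lemma integral_annulusKernel {r s : ℝ} (hr : 0 < r) (hrs : r ≤ s) (p : ℂ) :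
    ∫ z : ℂ, annulusKernel r s ‖z - p‖ =
      2 * volume.real (Metric.ball (0 : ℂ) 1) * Real.log (s / r) := by
  rw [integral_radial, setIntegral_congr_fun measurableSet_Ioi (annulusKernel_aux r s),
    setIntegral_indicator measurableSet_Icc,
    Set.inter_eq_right.2 (fun y (hy : y ∈ Set.Icc r s) => Set.mem_Ioi.2 (hr.trans_le hy.1)), integral_Icc_eq_integral_Ioc,
    ← intervalIntegral.integral_of_le hrs, integral_inv_of_pos hr (hr.trans_le hrs)]

lemma integrable_farKernel {s : ℝ} (hs : 0 < s) (p : ℂ) :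
    Integrable fun z : ℂ => farKernel s ‖z - p‖ := by
  refine integrable_radial p ?_
  rw [integrableOn_congr_fun (farKernel_aux s) measurableSet_Ioi]
  exact ((integrable_indicator_iff measurableSet_Ioi).2
    (integrableOn_Ioi_rpow_of_lt (by norm_num) hs)).integrableOn

lemma integral_farKernel {s : ℝ} (hs : 0 < s) (p : ℂ) :
    ∫ z : ℂ, farKernel s ‖z - p‖ = 2 * volume.real (Metric.ball (0 : ℂ) 1) * s⁻¹ := by
  rw [integral_radial, setIntegral_congr_fun measurableSet_Ioi (farKernel_aux s),
    setIntegral_indicator measurableSet_Ioi,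
    Set.inter_eq_right.2 (Set.Ioi_subset_Ioi hs.le), integral_Ioi_rpow_of_lt (by norm_num) hs]
  norm_num [Real.rpow_neg_one]

/-- Here `x`, `y`, `t` are the distances from `w` to `ζ₀`, `z`, `ζ₁`. Within `a/4` of `ζ₁`, or
within `r/2` of `ζ₀` or `z`, the other two factors are bounded below. Elsewhere `y ≥ x/4` and `t ≥
a/4` if `x ≤ 2a`, and both are at least `x/2` if `x > 2a`. Only the annulus gives a logarithm. -/
lemma kernel_pointwise {x y t r a : ℝ} (hx : 0 ≤ x) (hy : 0 ≤ y) (ht : 0 ≤ t) (hr : 0 < r)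
    (hra : 2 * r ≤ a) (hxy : r ≤ x + y) (hxy' : x ≤ y + r) (hxt : a ≤ x + t) (hxt' : x ≤ t + a)
    (hyt : a - r ≤ y + t) :
    (x * y * t)⁻¹ ≤ 16 / a ^ 2 * nearKernel (a / 4) t + 8 / (r * a) * nearKernel (r / 2) x +
      8 / (r * a) * nearKernel (r / 2) y + 16 / a * annulusKernel (r / 2) (2 * a) x +
      4 * farKernel (2 * a) x := by
  have ha : 0 < a := by linarith
  have n1 : 0 ≤ nearKernel (a / 4) t := Set.indicator_apply_nonneg fun _ => by positivity
  have n2 : 0 ≤ nearKernel (r / 2) x := Set.indicator_apply_nonneg fun _ => by positivity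
  have n3 : 0 ≤ nearKernel (r / 2) y := Set.indicator_apply_nonneg fun _ => by positivity
  have n4 : 0 ≤ annulusKernel (r / 2) (2 * a) x := Set.indicator_apply_nonneg fun _ => by positivity
  have n5 : 0 ≤ farKernel (2 * a) x := Set.indicator_apply_nonneg fun _ => by positivity
  have m1 : 0 ≤ 16 / a ^ 2 * nearKernel (a / 4) t := by positivity
  have m2 : 0 ≤ 8 / (r * a) * nearKernel (r / 2) x := by positivity
  have m3 : 0 ≤ 8 / (r * a) * nearKernel (r / 2) y := by positivity
  have m4 : 0 ≤ 16 / a * annulusKernel (r / 2) (2 * a) x := by positivity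
  by_cases h0 : x * y * t = 0
  · rw [h0, inv_zero]; positivity
  have hx0 : 0 < x := hx.lt_of_ne' (by rintro rfl; simp at h0)
  have hy0 : 0 < y := hy.lt_of_ne' (by rintro rfl; simp at h0)
  have ht0 : 0 < t := ht.lt_of_ne' (by rintro rfl; simp at h0)
  by_cases c1 : t < a / 4
  · have e : nearKernel (a / 4) t = t⁻¹ := Set.indicator_of_mem (s := Set.Iio (a / 4)) c1 _
    have : (x * y * t)⁻¹ ≤ 16 / a ^ 2 * nearKernel (a / 4) t := by
      rw [e, show 16 / a ^ 2 * t⁻¹ = ((a / 4 * (a / 4)) * t)⁻¹ by field_simp; norm_num]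
      gcongr <;> linarith
    linarith
  by_cases c2 : x < r / 2
  · have e : nearKernel (r / 2) x = x⁻¹ := Set.indicator_of_mem (s := Set.Iio (r / 2)) c2 _
    have : (x * y * t)⁻¹ ≤ 8 / (r * a) * nearKernel (r / 2) x := by
      rw [e, show 8 / (r * a) * x⁻¹ = (x * (r / 2) * (a / 4))⁻¹ by field_simp; norm_num]
      gcongr <;> linarith
    linarith
  by_cases c3 : y < r / 2
  · have e : nearKernel (r / 2) y = y⁻¹ := Set.indicator_of_mem (s := Set.Iio (r / 2)) c3 _
    have : (x * y * t)⁻¹ ≤ 8 / (r * a) * nearKernel (r / 2) y := by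
      rw [e, show 8 / (r * a) * y⁻¹ = ((r / 2) * y * (a / 4))⁻¹ by field_simp; norm_num]
      gcongr <;> linarith
    linarith
  push Not at c1 c2 c3
  by_cases c4 : x ≤ 2 * a
  · have e : annulusKernel (r / 2) (2 * a) x = (x ^ 2)⁻¹ :=
      Set.indicator_of_mem (s := Set.Icc (r / 2) (2 * a)) ⟨c2, c4⟩ _
    have hxy4 : x / 4 ≤ y := by
      by_cases hx2 : x ≤ 2 * r <;> linarith
    have : (x * y * t)⁻¹ ≤ 16 / a * annulusKernel (r / 2) (2 * a) x := by
      rw [e, show 16 / a * (x ^ 2)⁻¹ = (x * (x / 4) * (a / 4))⁻¹ by field_simp; norm_num]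
      gcongr
    linarith
  · push Not at c4
    have e : farKernel (2 * a) x = (x ^ 3)⁻¹ := Set.indicator_of_mem (s := Set.Ioi (2 * a)) c4 _
    have : (x * y * t)⁻¹ ≤ 4 * farKernel (2 * a) x := by
      rw [e, show 4 * (x ^ 3)⁻¹ = (x * (x / 2) * (x / 2))⁻¹ by field_simp; norm_num]
      gcongr <;> linarith
    linarith

/-- The three-pole kernel is integrable, with logarithmic blow-up when two poles collide. -/
lemma integral_threePole_le {z ζ₀ ζ₁ : ℂ} (hz : 0 < ‖z - ζ₀‖) (hra : 2 * ‖z - ζ₀‖ ≤ ‖ζ₁ - ζ₀‖) :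
    Integrable (fun w : ℂ => (‖w - ζ₀‖ * ‖w - z‖ * ‖w - ζ₁‖)⁻¹) ∧
    ∫ w : ℂ, (‖w - ζ₀‖ * ‖w - z‖ * ‖w - ζ₁‖)⁻¹ ≤
      60 * volume.real (Metric.ball (0 : ℂ) 1) *
        (Real.log (4 * ‖ζ₁ - ζ₀‖ / ‖z - ζ₀‖) / ‖ζ₁ - ζ₀‖) := by
  set r := ‖z - ζ₀‖ with hr
  set a := ‖ζ₁ - ζ₀‖ with ha
  have ha0 : 0 < a := by linarith
  have j1 := (integrable_nearKernel (a / 4) ζ₁).const_mul (16 / a ^ 2)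
  have j2 := (integrable_nearKernel (r / 2) ζ₀).const_mul (8 / (r * a))
  have j3 := (integrable_nearKernel (r / 2) z).const_mul (8 / (r * a))
  have j4 := (integrable_annulusKernel (half_pos hz) (2 * a) ζ₀).const_mul (16 / a)
  have j5 := (integrable_farKernel (show 0 < 2 * a by positivity) ζ₀).const_mul 4
  have j := (((j1.add j2).add j3).add j4).add j5
  have hpt : ∀ w : ℂ, (‖w - ζ₀‖ * ‖w - z‖ * ‖w - ζ₁‖)⁻¹ ≤
      16 / a ^ 2 * nearKernel (a / 4) ‖w - ζ₁‖ + 8 / (r * a) * nearKernel (r / 2) ‖w - ζ₀‖ +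
      8 / (r * a) * nearKernel (r / 2) ‖w - z‖ + 16 / a * annulusKernel (r / 2) (2 * a) ‖w - ζ₀‖ +
      4 * farKernel (2 * a) ‖w - ζ₀‖ := by
    intro w
    have t1 := norm_sub_le_norm_sub_add_norm_sub z w ζ₀
    have t2 := norm_sub_le_norm_sub_add_norm_sub w z ζ₀
    have t3 := norm_sub_le_norm_sub_add_norm_sub ζ₁ w ζ₀
    have t4 := norm_sub_le_norm_sub_add_norm_sub w ζ₁ ζ₀
    have t5 := norm_sub_le_norm_sub_add_norm_sub z w ζ₁
    have t6 := norm_sub_le_norm_sub_add_norm_sub ζ₁ z ζ₀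
    have s1 := norm_sub_rev z w
    have s2 := norm_sub_rev ζ₁ w
    have s3 := norm_sub_rev ζ₁ z
    apply kernel_pointwise (norm_nonneg _) (norm_nonneg _) (norm_nonneg _) hz hra <;> linarith
  have hmeas : AEStronglyMeasurable (fun w : ℂ => (‖w - ζ₀‖ * ‖w - z‖ * ‖w - ζ₁‖)⁻¹) volume :=
    Measurable.aestronglyMeasurable (by fun_prop)
  have hint : Integrable (fun w : ℂ => (‖w - ζ₀‖ * ‖w - z‖ * ‖w - ζ₁‖)⁻¹) := by
    refine j.mono' hmeas (Eventually.of_forall fun w => ?_)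
    rw [Real.norm_of_nonneg (by positivity)]
    exact hpt w
  refine ⟨hint, (integral_mono hint j hpt).trans ?_⟩
  rw [integral_add' (((j1.add j2).add j3).add j4) j5, integral_add' ((j1.add j2).add j3) j4,
    integral_add' (j1.add j2) j3, integral_add' j1 j2]
  simp only [integral_const_mul]
  rw [integral_nearKernel (by positivity), integral_nearKernel (by positivity),
    integral_nearKernel (by positivity), integral_annulusKernel (half_pos hz) (by linarith),
    integral_farKernel (by positivity)]
  set κ := volume.real (Metric.ball (0 : ℂ) 1) with hκ
  have hκ0 : 0 ≤ κ := measureReal_nonneg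
  -- Since `a ≥ 2r`, the argument is at least `8 > e`; this absorbs the constant terms, giving `28 +
  -- 32 = 60`.
  have hlog : 1 ≤ Real.log (4 * a / r) := by
    rw [Real.le_log_iff_exp_le (by positivity)]
    have h1 := Real.exp_one_lt_d9
    have h2 : 8 ≤ 4 * a / r := by rw [le_div_iff₀ hz]; linarith
    linarith
  rw [show 2 * a / (r / 2) = 4 * a / r by field_simp; norm_num]
  set L := Real.log (4 * a / r)
  have e : 16 / a ^ 2 * (2 * κ * (a / 4)) + 8 / (r * a) * (2 * κ * (r / 2)) +
      8 / (r * a) * (2 * κ * (r / 2)) + 16 / a * (2 * κ * L) + 4 * (2 * κ * (2 * a)⁻¹) =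
      κ / a * (28 + 32 * L) := by
    field_simp
    ring
  rw [e]
  calc κ / a * (28 + 32 * L) ≤ κ / a * (60 * L) := by gcongr; linarith
    _ = _ := by ring

/-! ### The Cauchy–Pompeiu formula. -/

/-- The regularised Cauchy kernel with pole at `p`. -/
noncomputable def regCauchy (ε : ℝ) (p w : ℂ) : ℂ :=
  starRingEnd ℂ (w - p) / (((‖w - p‖ ^ 2 + ε ^ 2 : ℝ) : ℝ) : ℂ)

lemma contDiff_regCauchy {ε : ℝ} (hε : 0 < ε) (p : ℂ) : ContDiff ℝ ∞ (regCauchy ε p) := by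
  have h1 : ContDiff ℝ ∞ fun w : ℂ => starRingEnd ℂ (w - p) :=
    Complex.conjCLE.contDiff.comp (contDiff_id.sub contDiff_const)
  have h2 : ContDiff ℝ ∞ fun w : ℂ => ((‖w - p‖ ^ 2 + ε ^ 2 : ℝ) : ℂ) :=
    Complex.ofRealCLM.contDiff.comp
      (((contDiff_id.sub contDiff_const).norm_sq ℝ).add contDiff_const)
  unfold regCauchy
  simp only [div_eq_mul_inv]
  refine h1.mul (h2.inv fun w => ?_)
  rw [Complex.ofReal_ne_zero]
  positivity

lemma dbar_conj_sub (p w : ℂ) : dbar (fun w => starRingEnd ℂ (w - p)) w = 1 := by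
  have h : HasFDerivAt (fun w : ℂ => starRingEnd ℂ (w - p)) _ w :=
    (Complex.conjCLE : ℂ →L[ℝ] ℂ).hasFDerivAt.comp w ((hasFDerivAt_id w).sub_const p)
  unfold dbar
  rw [h.fderiv]
  norm_num

lemma dbar_sub_const (p w : ℂ) : dbar (fun w => w - p) w = 0 := by
  have h : HasFDerivAt (fun w : ℂ => w - p) _ w := (hasFDerivAt_id (𝕜 := ℝ) w).sub_const p
  unfold dbar
  rw [h.fderiv]
  simp

/-- Apply the Leibniz rule to `regCauchy · q = conj (w - p)`, where `q = |w - p|² + ε²` has `∂̄q = w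
- p`, and solve for the unknown derivative. -/
lemma dbar_regCauchy {ε : ℝ} (hε : 0 < ε) (p w : ℂ) :
    dbar (regCauchy ε p) w = ((ε ^ 2 / (‖w - p‖ ^ 2 + ε ^ 2) ^ 2 : ℝ) : ℂ) := by
  set q : ℂ → ℂ := fun w => (w - p) * starRingEnd ℂ (w - p) + (ε ^ 2 : ℝ) with hq
  have hq' : ∀ w, q w = ((‖w - p‖ ^ 2 + ε ^ 2 : ℝ) : ℂ) := by
    intro w
    simp only [hq]
    rw [Complex.mul_conj, Complex.normSq_eq_norm_sq]
    push_cast; ring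
  have hq0 : ∀ w, q w ≠ 0 := fun w => by
    rw [hq', Complex.ofReal_ne_zero]; positivity
  have hd1 : Differentiable ℝ fun w : ℂ => w - p := by fun_prop
  have hd2 : Differentiable ℝ fun w : ℂ => starRingEnd ℂ (w - p) :=
    Complex.conjCLE.differentiable.comp hd1
  have hqd : DifferentiableAt ℝ q w := ((hd1 w).mul (hd2 w)).add_const _
  have hdq : dbar q w = w - p := by
    have e : dbar q w = dbar (fun w => (w - p) * starRingEnd ℂ (w - p)) w := by
      unfold dbar
      rw [hq, fderiv_add_const]
    rw [e, dbar_mul (hd1 w) (hd2 w), dbar_sub_const, dbar_conj_sub]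
    ring
  have hprod : (fun w => regCauchy ε p w * q w) = fun w => starRingEnd ℂ (w - p) := by
    funext w
    unfold regCauchy
    rw [← hq', div_mul_cancel₀ _ (hq0 w)]
  have h := dbar_mul ((contDiff_regCauchy hε p).differentiable (by simp) w) hqd
  rw [hprod, dbar_conj_sub, hdq] at h
  have h2 : dbar (regCauchy ε p) w * q w * q w = (ε ^ 2 : ℝ) := by
    have : regCauchy ε p w * q w = starRingEnd ℂ (w - p) := congrFun hprod w
    have h3 : q w = (w - p) * starRingEnd ℂ (w - p) + (ε ^ 2 : ℝ) := rfl
    linear_combination (-q w) * h - (w - p) * this + h3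
  push_cast at hq' h2 ⊢
  rw [← hq', eq_div_iff (pow_ne_zero 2 (hq0 w)), ← h2]
  ring

lemma norm_regCauchy_le (ε : ℝ) (p w : ℂ) : ‖regCauchy ε p w‖ ≤ ‖w - p‖⁻¹ := by
  unfold regCauchy
  rw [norm_div, RCLike.norm_conj, Complex.norm_real, Real.norm_of_nonneg (by positivity)]
  by_cases h : ‖w - p‖ = 0
  · simp [h]
  have : 0 < ‖w - p‖ := lt_of_le_of_ne (norm_nonneg _) (Ne.symm h)
  rw [div_le_iff₀ (by positivity)]
  have : ‖w - p‖⁻¹ * ‖w - p‖ ^ 2 = ‖w - p‖ := by field_simp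
  rw [mul_add, this]
  have : 0 ≤ ‖w - p‖⁻¹ * ε ^ 2 := by positivity
  linarith

lemma tendsto_regCauchy (p w : ℂ) :
    Tendsto (fun ε => regCauchy ε p w) (𝓝[>] 0) (𝓝 ((w - p)⁻¹)) := by
  by_cases h : w - p = 0
  · simp [regCauchy, h]
  have hn : (‖w - p‖ ^ 2 : ℝ) ≠ 0 := by simpa using h
  have h1 : Tendsto (fun ε : ℝ => ((‖w - p‖ ^ 2 + ε ^ 2 : ℝ) : ℂ)) (𝓝[>] 0)
      (𝓝 ((‖w - p‖ ^ 2 + 0 ^ 2 : ℝ) : ℂ)) := by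
    apply tendsto_nhdsWithin_of_tendsto_nhds
    have : Continuous fun ε : ℝ => ((‖w - p‖ ^ 2 + ε ^ 2 : ℝ) : ℂ) := by fun_prop
    exact this.tendsto 0
  have h2 := (tendsto_const_nhds (x := starRingEnd ℂ (w - p))).div h1 (by
    rw [Complex.ofReal_ne_zero]; simpa using h)
  have e : starRingEnd ℂ (w - p) / ((‖w - p‖ ^ 2 + 0 ^ 2 : ℝ) : ℂ) = (w - p)⁻¹ := by
    rw [Complex.inv_def, Complex.normSq_eq_norm_sq]
    push_cast; ring
  rw [e] at h2
  exact h2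

/-- `ε² / (|w - p|² + ε²)²` is an approximate identity, up to the constant `cauchyConst`. -/
lemma tendsto_integral_mul_poisson {h : ℂ → ℂ} (hc : Continuous h) (hs : HasCompactSupport h)
    (p : ℂ) :
    Tendsto (fun ε : ℝ => ∫ w, h w * ((ε ^ 2 / (‖w - p‖ ^ 2 + ε ^ 2) ^ 2 : ℝ) : ℂ)) (𝓝[>] 0)
      (𝓝 (h p * cauchyConst)) := by
  obtain ⟨B, hB⟩ := hs.exists_bound_of_continuous hc
  have e : ∀ ε : ℝ, 0 < ε → ∫ w, h w * ((ε ^ 2 / (‖w - p‖ ^ 2 + ε ^ 2) ^ 2 : ℝ) : ℂ) =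
      ∫ u, h (ε • u + p) * ((((1 + ‖u‖ ^ 2) ^ 2)⁻¹ : ℝ) : ℂ) := by
    intro ε hε
    rw [← integral_add_right_eq_self _ p]
    have h1 := Measure.integral_comp_smul (volume : Measure ℂ)
      (fun w => h (w + p) * ((ε ^ 2 / (‖w + p - p‖ ^ 2 + ε ^ 2) ^ 2 : ℝ) : ℂ)) ε
    rw [Complex.finrank_real_complex, abs_of_pos (by positivity),
      eq_inv_smul_iff₀ (pow_ne_zero 2 hε.ne')] at h1
    rw [← h1, ← integral_smul]
    refine integral_congr_ae (Eventually.of_forall fun u => ?_)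
    simp only
    rw [add_sub_cancel_right, norm_smul, Real.norm_of_nonneg hε.le, Complex.real_smul,
      mul_left_comm, ← Complex.ofReal_mul]
    congr 2
    field_simp
    ring
  have hlim : Tendsto (fun ε : ℝ => ∫ u, h (ε • u + p) * ((((1 + ‖u‖ ^ 2) ^ 2)⁻¹ : ℝ) : ℂ)) (𝓝[>] 0)
      (𝓝 (∫ u : ℂ, h p * ((((1 + ‖u‖ ^ 2) ^ 2)⁻¹ : ℝ) : ℂ))) := by
    refine tendsto_integral_filter_of_dominated_convergence
      (fun u : ℂ => B * ((1 + ‖u‖ ^ 2) ^ 2)⁻¹) ?_ ?_ (integrable_cauchyConst.const_mul B) ?_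
    · refine Eventually.of_forall fun ε => ?_
      refine Measurable.aestronglyMeasurable ?_
      have := hc.measurable
      fun_prop
    · refine Eventually.of_forall fun ε => Eventually.of_forall fun u => ?_
      rw [norm_mul, Complex.norm_real, Real.norm_of_nonneg (by positivity)]
      gcongr
      exact hB _
    · refine Eventually.of_forall fun u => ?_
      refine Tendsto.mul_const _ ?_
      apply tendsto_nhdsWithin_of_tendsto_nhds
      have : Continuous fun ε : ℝ => h (ε • u + p) := by fun_prop
      simpa using this.tendsto 0
  rw [integral_const_mul, integral_complex_ofReal] at hlim
  refine hlim.congr' ?_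
  filter_upwards [self_mem_nhdsWithin] with ε hε
  exact (e ε hε).symm

lemma integrable_div_sub {h : ℂ → ℂ} (hm : Measurable h) {B R : ℝ} (hB : ∀ w, ‖h w‖ ≤ B)
    (p : ℂ) (hR : ∀ w, R ≤ ‖w - p‖ → h w = 0) :
    Integrable fun w => ‖h w‖ * ‖w - p‖⁻¹ := by
  refine ((integrable_nearKernel R p).const_mul B).mono'
    (Measurable.aestronglyMeasurable (by fun_prop)) (Eventually.of_forall fun w => ?_)
  rw [Real.norm_of_nonneg (by positivity)]
  by_cases hw : ‖w - p‖ < R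
  · rw [show nearKernel R ‖w - p‖ = ‖w - p‖⁻¹ from Set.indicator_of_mem (s := Set.Iio R) hw _]
    gcongr
    exact hB w
  · rw [hR w (not_lt.1 hw), norm_zero, zero_mul,
      show nearKernel R ‖w - p‖ = 0 from Set.indicator_of_notMem (s := Set.Iio R) hw _, mul_zero]

/-- The Cauchy–Pompeiu formula for a function with bounded weak `∂̄`-derivative. -/
lemma cauchy_pompeiu {V ν χ : ℂ → ℂ} (hV : Continuous V) (hν : Measurable ν) {M : ℝ}
    (hM : ∀ z, ‖ν z‖ ≤ M) (hw : HasWeakDbar Set.univ V ν) (hχ : ContDiff ℝ ∞ χ)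
    (hχc : HasCompactSupport χ) (p : ℂ) :
    Integrable (fun w => (ν w * χ w + V w * dbar χ w) * (w - p)⁻¹) ∧
    V p * χ p * cauchyConst = - ∫ w, (ν w * χ w + V w * dbar χ w) * (w - p)⁻¹ := by
  set h : ℂ → ℂ := fun w => ν w * χ w + V w * dbar χ w with hh
  have hdc := continuous_dbar hχ
  have hhm : Measurable h := by
    have := hV.measurable; have := hχ.continuous.measurable; have := hdc.measurable
    fun_prop
  obtain ⟨B1, hB1⟩ := hχc.exists_bound_of_continuous hχ.continuous
  obtain ⟨B2, hB2⟩ := (hasCompactSupport_dbar hχc).mul_left.exists_bound_of_continuous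
    (hV.mul hdc)
  have hM0 : 0 ≤ M := (norm_nonneg _).trans (hM 0)
  have hhB : ∀ w, ‖h w‖ ≤ M * B1 + B2 := fun w => (norm_add_le _ _).trans (by
    gcongr
    · rw [norm_mul]; gcongr
      · exact hM w
      · exact hB1 w
    · exact hB2 w)
  obtain ⟨R, hR⟩ := hχc.isCompact.isBounded.subset_ball p
  have hhR : ∀ w, R ≤ ‖w - p‖ → h w = 0 := by
    intro w hwR
    have hnot : w ∉ tsupport χ := fun hmem => by
      have := hR hmem
      rw [Metric.mem_ball, dist_eq_norm] at this
      linarith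
    have h2 : dbar χ w = 0 := by
      by_contra hne; exact hnot (support_dbar_subset χ hne)
    simp only [hh]
    rw [image_eq_zero_of_notMem_tsupport hnot, h2, mul_zero, mul_zero, add_zero]
  have hdom := integrable_div_sub hhm hhB p hhR
  have hint : Integrable fun w => h w * (w - p)⁻¹ := by
    refine hdom.mono' (Measurable.aestronglyMeasurable (by fun_prop)) (Eventually.of_forall fun w => ?_)
    rw [norm_mul, norm_inv]
  refine ⟨hint, ?_⟩
  have hVχ : Continuous fun w => V w * χ w := hV.mul hχ.continuous
  have hlim1 := tendsto_integral_mul_poisson hVχ hχc.mul_left p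
  have hlim2 : Tendsto (fun ε : ℝ => ∫ w, h w * regCauchy ε p w) (𝓝[>] 0)
      (𝓝 (∫ w, h w * (w - p)⁻¹)) := by
    refine tendsto_integral_filter_of_dominated_convergence _ ?_ ?_ hdom ?_
    · filter_upwards [self_mem_nhdsWithin] with ε hε
      exact (hhm.mul (contDiff_regCauchy hε p).continuous.measurable).aestronglyMeasurable
    · refine Eventually.of_forall fun ε => Eventually.of_forall fun w => ?_
      rw [norm_mul]
      gcongr
      exact norm_regCauchy_le ε p w
    · exact Eventually.of_forall fun w => (tendsto_regCauchy p w).const_mul _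
  -- The product of `χ` and the regularised kernel is a legitimate test function. The weak equation
  -- for it equates the two families whose limits are `hlim1` and the negative of `hlim2`.
  refine tendsto_nhds_unique hlim1 (hlim2.neg.congr' ?_)
  filter_upwards [self_mem_nhdsWithin] with ε hε
  have hn := contDiff_regCauchy hε p
  have hweak := hw (fun w => χ w * regCauchy ε p w) (hχ.mul hn) hχc.mul_right (Set.subset_univ _)
  rw [Measure.restrict_univ] at hweak
  have i1 : Integrable fun w => ν w * (χ w * regCauchy ε p w) :=
    ((hχ.mul hn).continuous.integrable_of_hasCompactSupport hχc.mul_right).bdd_mul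
      hν.aestronglyMeasurable (Eventually.of_forall hM)
  have i2 : Integrable fun w => V w * dbar χ w * regCauchy ε p w :=
    ((hV.mul hdc).mul hn.continuous).integrable_of_hasCompactSupport
      ((hasCompactSupport_dbar hχc).mul_left.mul_right)
  have i3 : Integrable fun w => V w * χ w * ((ε ^ 2 / (‖w - p‖ ^ 2 + ε ^ 2) ^ 2 : ℝ) : ℂ) := by
    have := hVχ.mul (continuous_dbar hn)
    rw [funext fun w => dbar_regCauchy hε p w] at this
    exact this.integrable_of_hasCompactSupport (hχc.mul_left.mul_right)
  have e1 : ∫ w, V w * dbar (fun w => χ w * regCauchy ε p w) w =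
      (∫ w, V w * dbar χ w * regCauchy ε p w) +
        ∫ w, V w * χ w * ((ε ^ 2 / (‖w - p‖ ^ 2 + ε ^ 2) ^ 2 : ℝ) : ℂ) := by
    rw [← integral_add i2 i3]
    refine integral_congr_ae (Eventually.of_forall fun w => ?_)
    simp only
    rw [dbar_mul (hχ.differentiable (by simp) w) (hn.differentiable (by simp) w),
      dbar_regCauchy hε]
    ring
  have e2 : ∫ w, h w * regCauchy ε p w =
      (∫ w, ν w * (χ w * regCauchy ε p w)) + ∫ w, V w * dbar χ w * regCauchy ε p w := by
    rw [← integral_add i1 i2]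
    refine integral_congr_ae (Eventually.of_forall fun w => ?_)
    simp only [hh]; ring
  rw [e1] at hweak
  rw [e2]
  linear_combination -hweak

/-! ### Growth `r log (1/r)` near the zeros. -/

/-- Cutoff functions equal to one on `|w| ≤ R`, zero for `|w| ≥ 2R`, with gradient `O(1/R)`. -/
lemma exists_cutoff : ∃ B : ℝ, 0 ≤ B ∧ ∀ R : ℝ, 0 < R → ∃ χ : ℂ → ℂ, ContDiff ℝ ∞ χ ∧
    HasCompactSupport χ ∧ (∀ w, ‖w‖ ≤ R → χ w = 1) ∧ (∀ w, ‖χ w‖ ≤ 1) ∧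
    (∀ w, ‖dbar χ w‖ ≤ B / R) ∧ ∀ w, dbar χ w ≠ 0 → R ≤ ‖w‖ ∧ ‖w‖ ≤ 2 * R := by
  let f : ContDiffBump (0 : ℂ) := ⟨1, 2, one_pos, one_lt_two⟩
  have hf : ContDiff ℝ ∞ f := f.contDiff
  obtain ⟨B, hB⟩ := (f.hasCompactSupport.fderiv ℝ).exists_bound_of_continuous
    (hf.continuous_fderiv (by simp))
  refine ⟨B, (norm_nonneg _).trans (hB 0), fun R hR => ?_⟩
  set χ : ℂ → ℂ := fun w => (f (R⁻¹ • w) : ℂ) with hχ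
  have hχs : ContDiff ℝ ∞ χ :=
    Complex.ofRealCLM.contDiff.comp (hf.comp (show ContDiff ℝ ∞ fun w : ℂ => R⁻¹ • w by fun_prop))
  have hnorm : ∀ w : ℂ, ‖R⁻¹ • w‖ = ‖w‖ / R := fun w => by
    rw [norm_smul, norm_inv, Real.norm_of_nonneg hR.le]; ring
  have hone : ∀ w : ℂ, ‖w‖ ≤ R → χ w = 1 := fun w hw => by
    simp only [hχ]
    rw [f.one_of_mem_closedBall, Complex.ofReal_one]
    rw [mem_closedBall_zero_iff, hnorm]
    exact (div_le_one hR).2 hw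
  have hsupp : tsupport χ ⊆ Metric.closedBall 0 (2 * R) := by
    refine closure_minimal (fun w hw => ?_) Metric.isClosed_closedBall
    have h1 : R⁻¹ • w ∈ Function.support f := by simpa [hχ] using hw
    rw [f.support_eq, mem_ball_zero_iff, hnorm, div_lt_iff₀ hR] at h1
    rw [mem_closedBall_zero_iff]
    exact h1.le
  have hder : ∀ w, ‖fderiv ℝ χ w‖ ≤ B / R := by
    intro w
    have h1 : HasFDerivAt (fun w : ℂ => R⁻¹ • w) (R⁻¹ • ContinuousLinearMap.id ℝ ℂ) w :=
      (R⁻¹ • ContinuousLinearMap.id ℝ ℂ).hasFDerivAt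
    have h2 : HasFDerivAt χ _ w := Complex.ofRealCLM.hasFDerivAt.comp w
      ((hf.differentiable (by simp) (R⁻¹ • w)).hasFDerivAt.comp w h1)
    rw [h2.fderiv]
    refine ContinuousLinearMap.opNorm_le_bound _ (div_nonneg ((norm_nonneg _).trans (hB 0)) hR.le)
      fun v => ?_
    have h3 := (fderiv ℝ f (R⁻¹ • w)).le_opNorm (R⁻¹ • v)
    rw [hnorm] at h3
    simp only [ContinuousLinearMap.comp_apply, Complex.ofRealCLM_apply, Complex.norm_real]
    refine h3.trans ?_
    calc _ ≤ B * (‖v‖ / R) := by gcongr; exact hB _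
      _ = _ := by ring
  refine ⟨χ, hχs, (isCompact_closedBall 0 (2 * R)).of_isClosed_subset (isClosed_tsupport _) hsupp,
    hone, fun w => ?_, fun w => (norm_dbar_le_norm_fderiv χ w).trans (hder w), fun w hw => ⟨?_, ?_⟩⟩
  · simp only [hχ, Complex.norm_real, Real.norm_of_nonneg f.nonneg]
    exact f.le_one
  · by_contra! hlt
    apply hw
    have : χ =ᶠ[𝓝 w] fun _ => 1 := by
      filter_upwards [continuous_norm.continuousAt.eventually (gt_mem_nhds hlt)] with u hu
      exact hone u (le_of_lt hu)
    unfold dbar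
    rw [this.fderiv_eq]
    simp
  · exact mem_closedBall_zero_iff.1 (hsupp (support_dbar_subset χ hw))

/-- The coefficients are those that cancel the `1/w` and `1/w²` terms at infinity. The factor `z -
ζ₀` on the right is the source of the gain `r`. -/
lemma partial_fractions {z ζ₀ ζ₁ w : ℂ} (h01 : ζ₁ ≠ ζ₀)
    (hz : w ≠ z) (hw0 : w ≠ ζ₀) (hw1 : w ≠ ζ₁) :
    (w - z)⁻¹ - (z - ζ₁) / (ζ₀ - ζ₁) * (w - ζ₀)⁻¹ + (z - ζ₀) / (ζ₀ - ζ₁) * (w - ζ₁)⁻¹ =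
      (z - ζ₀) * (z - ζ₁) * ((w - ζ₀) * (w - z) * (w - ζ₁))⁻¹ := by
  have := sub_ne_zero.2 hz
  have := sub_ne_zero.2 hw0
  have := sub_ne_zero.2 hw1
  have := sub_ne_zero.2 h01.symm
  field_simp
  ring

/-- A function with bounded weak `∂̄`-derivative on the plane, vanishing at two points and
(as a vector field) at infinity, is `O(r log (1/r))` near its zeros. -/
theorem norm_le_of_vanish {V ν : ℂ → ℂ} (hV : Continuous V) (hν : Measurable ν) {M : ℝ}
    (hM : ∀ z, ‖ν z‖ ≤ M) (hw : HasWeakDbar Set.univ V ν)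
    (hinf : Tendsto (fun w => V w / w ^ 2) (Bornology.cobounded ℂ) (𝓝 0))
    {z ζ₀ ζ₁ : ℂ} (hζ₀ : V ζ₀ = 0) (hζ₁ : V ζ₁ = 0)
    (hz : 0 < ‖z - ζ₀‖) (hra : 2 * ‖z - ζ₀‖ ≤ ‖ζ₁ - ζ₀‖) :
    cauchyConst * ‖V z‖ ≤ 90 * volume.real (Metric.ball (0 : ℂ) 1) * M *
      (‖z - ζ₀‖ * Real.log (4 * ‖ζ₁ - ζ₀‖ / ‖z - ζ₀‖)) := by
  obtain ⟨hKi, hKle⟩ := integral_threePole_le hz hra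
  set r := ‖z - ζ₀‖ with hr
  set a := ‖ζ₁ - ζ₀‖ with ha
  have ha0 : 0 < a := by linarith
  have hM0 : 0 ≤ M := (norm_nonneg _).trans (hM 0)
  set κ := volume.real (Metric.ball (0 : ℂ) 1) with hκ
  have hκ0 : 0 ≤ κ := measureReal_nonneg
  have hb : ‖z - ζ₁‖ ≤ 3 / 2 * a := by
    have := norm_sub_le_norm_sub_add_norm_sub z ζ₀ ζ₁
    rw [norm_sub_rev ζ₀ ζ₁] at this
    linarith
  have hb0 : 0 < ‖z - ζ₁‖ := by
    have := norm_sub_le_norm_sub_add_norm_sub ζ₁ z ζ₀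
    rw [norm_sub_rev ζ₁ z] at this
    linarith
  set k : ℂ → ℝ := fun w => (‖w - ζ₀‖ * ‖w - z‖ * ‖w - ζ₁‖)⁻¹ with hk
  set A := r * ‖z - ζ₁‖ with hA
  have hA0 : 0 < A := mul_pos hz hb0
  obtain ⟨B, hB0, hcut⟩ := exists_cutoff
  have main : ∀ e : ℝ, 0 < e →
      cauchyConst * ‖V z‖ ≤ M * A * (∫ w, k w) + 128 * B * A * κ * e := by
    intro e he
    have hev : ∀ᶠ w in Bornology.cobounded ℂ, ‖V w / w ^ 2‖ ≤ e := by
      have := hinf.norm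
      rw [norm_zero] at this
      exact this.eventually_le_const he
    rw [← comap_norm_atTop, eventually_comap, eventually_atTop] at hev
    obtain ⟨R₀, hR₀⟩ := hev
    -- Beyond `R` one has `|V| ≤ e|w|²`, and the three poles have modulus at most `R/2`, so each is
    -- at distance at least `R/2` from any `w` with `|w| ≥ R`.
    set R := max (max R₀ 1) (2 * (‖z‖ + ‖ζ₀‖ + ‖ζ₁‖)) with hRdef
    have hR1 : 1 ≤ R := (le_max_right _ _).trans (le_max_left _ _)
    have hR0 : 0 < R := by linarith
    have hRR₀ : R₀ ≤ R := (le_max_left _ _).trans (le_max_left _ _)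
    have hRn : 2 * (‖z‖ + ‖ζ₀‖ + ‖ζ₁‖) ≤ R := le_max_right _ _
    have nz := norm_nonneg z
    have n0 := norm_nonneg ζ₀
    have n1 := norm_nonneg ζ₁
    obtain ⟨χ, hχs, hχc, hχ1, hχle, hχd, hχsupp⟩ := hcut R hR0
    set h : ℂ → ℂ := fun w => ν w * χ w + V w * dbar χ w with hh
    have F (p : ℂ) := cauchy_pompeiu hV hν hM hw hχs hχc p
    have hcomb : V z * cauchyConst = - ∫ w, h w *
        ((w - z)⁻¹ - (z - ζ₁) / (ζ₀ - ζ₁) * (w - ζ₀)⁻¹ + (z - ζ₀) / (ζ₀ - ζ₁) * (w - ζ₁)⁻¹) := by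
      have e1 : (fun w => h w * ((w - z)⁻¹ - (z - ζ₁) / (ζ₀ - ζ₁) * (w - ζ₀)⁻¹ +
          (z - ζ₀) / (ζ₀ - ζ₁) * (w - ζ₁)⁻¹)) =
          fun w => (h w * (w - z)⁻¹ - (z - ζ₁) / (ζ₀ - ζ₁) * (h w * (w - ζ₀)⁻¹)) +
            (z - ζ₀) / (ζ₀ - ζ₁) * (h w * (w - ζ₁)⁻¹) := by
        funext w; ring
      have i1 : Integrable fun w => h w * (w - z)⁻¹ - (z - ζ₁) / (ζ₀ - ζ₁) * (h w * (w - ζ₀)⁻¹) :=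
        (F z).1.sub ((F ζ₀).1.const_mul _)
      rw [e1, integral_add i1 ((F ζ₁).1.const_mul _),
        integral_sub (F z).1 ((F ζ₀).1.const_mul _), integral_const_mul, integral_const_mul]
      have f1 := (F z).2
      have f2 := (F ζ₀).2
      have f3 := (F ζ₁).2
      rw [hχ1 z (by linarith), mul_one] at f1
      rw [hζ₀, zero_mul, zero_mul] at f2
      rw [hζ₁, zero_mul, zero_mul] at f3
      linear_combination f1 - (z - ζ₁) / (ζ₀ - ζ₁) * f2 + (z - ζ₀) / (ζ₀ - ζ₁) * f3
    have hfar : ∀ w p : ℂ, R ≤ ‖w‖ → ‖p‖ ≤ R / 2 → R / 2 ≤ ‖w - p‖ := fun w p h1 h2 => by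
      have := norm_sub_norm_le w p; linarith
    have hbound : ∀ᵐ w, ‖h w *
        ((w - z)⁻¹ - (z - ζ₁) / (ζ₀ - ζ₁) * (w - ζ₀)⁻¹ + (z - ζ₀) / (ζ₀ - ζ₁) * (w - ζ₁)⁻¹)‖ ≤
        M * A * k w + (Metric.closedBall (0 : ℂ) (2 * R)).indicator
          (fun _ => 32 * e * B * A / R ^ 2) w := by
      have hae : ∀ᵐ w : ℂ, w ∉ ({z, ζ₀, ζ₁} : Set ℂ) :=
        (Set.toFinite _).countable.ae_notMem volume
      filter_upwards [hae] with w hwne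
      simp only [Set.mem_insert_iff, Set.mem_singleton_iff, not_or] at hwne
      rw [partial_fractions (sub_ne_zero.1 (norm_pos_iff.1 ha0)) hwne.1 hwne.2.1 hwne.2.2, norm_mul]
      have ek : ‖(z - ζ₀) * (z - ζ₁) * ((w - ζ₀) * (w - z) * (w - ζ₁))⁻¹‖ = A * k w := by
        simp only [norm_mul, norm_inv, hk, hA, hr]
      rw [ek]
      have hk0 : 0 ≤ k w := by simp only [hk]; positivity
      have h1 : ‖ν w * χ w‖ ≤ M := by
        rw [norm_mul]
        calc _ ≤ M * 1 := mul_le_mul (hM w) (hχle w) (norm_nonneg _) hM0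
          _ = M := mul_one _
      have h2 : ‖V w * dbar χ w‖ * (A * k w) ≤ (Metric.closedBall (0 : ℂ) (2 * R)).indicator
          (fun _ => 32 * e * B * A / R ^ 2) w := by
        by_cases hd : dbar χ w = 0
        · rw [hd, mul_zero, norm_zero, zero_mul]
          exact Set.indicator_nonneg (fun _ _ => by positivity) w
        obtain ⟨hwR, hwR2⟩ := hχsupp w hd
        rw [Set.indicator_of_mem (mem_closedBall_zero_iff.2 hwR2), norm_mul]
        have hVw : ‖V w‖ ≤ e * (2 * R) ^ 2 := by
          have := hR₀ ‖w‖ (hRR₀.trans hwR) w rfl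
          rw [norm_div, norm_pow, div_le_iff₀ (by have := hR0.trans_le hwR; positivity)] at this
          refine this.trans ?_
          gcongr
        have hkw : k w ≤ (R / 2 * (R / 2) * (R / 2))⁻¹ := by
          simp only [hk]
          have q0 := hfar w ζ₀ hwR (by linarith)
          have qz := hfar w z hwR (by linarith)
          have q1 := hfar w ζ₁ hwR (by linarith)
          gcongr
        -- Growth `R²`, gradient `1/R` and kernel `R⁻³` give `R⁻²`, which the area of the disc
        -- cancels; the cutoff error is a constant times `e`, uniformly in `R`.
        calc ‖V w‖ * ‖dbar χ w‖ * (A * k w)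
            ≤ (e * (2 * R) ^ 2) * (B / R) * (A * (R / 2 * (R / 2) * (R / 2))⁻¹) := by
              gcongr
              exact hχd w
          _ = 32 * e * B * A / R ^ 2 := by field_simp; ring
      calc ‖h w‖ * (A * k w) ≤ (M + ‖V w * dbar χ w‖) * (A * k w) := by
            gcongr
            exact (norm_add_le _ _).trans (by linarith)
        _ = M * A * k w + ‖V w * dbar χ w‖ * (A * k w) := by ring
        _ ≤ _ := by linarith
    have hind : Integrable ((Metric.closedBall (0 : ℂ) (2 * R)).indicator
          (fun _ => 32 * e * B * A / R ^ 2)) :=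
      (integrable_indicator_iff Metric.isClosed_closedBall.measurableSet).2
        (integrableOn_const (isCompact_closedBall 0 (2 * R)).measure_lt_top.ne)
    have hfin := norm_integral_le_of_norm_le ((hKi.const_mul (M * A)).add hind) hbound
    rw [integral_add' (hKi.const_mul (M * A)) hind, integral_const_mul,
      integral_indicator Metric.isClosed_closedBall.measurableSet, setIntegral_const, smul_eq_mul,
      Measure.addHaar_real_closedBall _ _ (by positivity), Complex.finrank_real_complex] at hfin
    have hc : cauchyConst * ‖V z‖ = ‖V z * cauchyConst‖ := by
      rw [norm_mul, Complex.norm_real, Real.norm_of_nonneg cauchyConst_pos.le, mul_comm]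
    rw [hc, hcomb, norm_neg]
    refine hfin.trans (le_of_eq ?_)
    rw [← hκ]
    field_simp
    ring
  have hlim : cauchyConst * ‖V z‖ ≤ M * A * (∫ w, k w) := by
    refine le_of_forall_pos_le_add fun e' he' => ?_
    have hq : 0 ≤ 128 * B * A * κ := by positivity
    have := main (e' / (128 * B * A * κ + 1)) (by positivity)
    refine this.trans ?_
    gcongr
    rw [mul_div_assoc', div_le_iff₀ (by positivity)]
    nlinarith
  refine hlim.trans ?_
  have hlog : 0 ≤ Real.log (4 * a / r) := Real.log_nonneg (by
    rw [le_div_iff₀ hz]; linarith)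
  have hAle : A ≤ r * (3 / 2 * a) := by rw [hA]; gcongr
  calc M * A * (∫ w, k w) ≤ M * (r * (3 / 2 * a)) * (60 * κ * (Real.log (4 * a / r) / a)) := by
        gcongr
    _ = _ := by field_simp; ring

/-! ### The smoothed distance and the logarithmic cutoff. -/

/-- Lipschitz functions can be uniformly approximated by smooth ones with the same constant. -/
lemma exists_smooth_lipschitz_approx {g : ℂ → ℝ} (hg : LipschitzWith 1 g) {ε : ℝ} (hε : 0 < ε) :
    ∃ ρ : ℂ → ℝ, ContDiff ℝ ∞ ρ ∧ (∀ z, |ρ z - g z| ≤ ε) ∧ ∀ z, ‖fderiv ℝ ρ z‖ ≤ 1 := by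
  let φ : ContDiffBump (0 : ℂ) := ⟨ε / 2, ε, by positivity, by linarith⟩
  have hφ : ContDiff ℝ ∞ (φ.normed volume) := φ.contDiff_normed
  set ρ : ℂ → ℝ := φ.normed volume ⋆[ContinuousLinearMap.lsmul ℝ ℝ, volume] g with hρ
  have hi (x : ℂ) : Integrable fun t => φ.normed volume t * g (x - t) :=
    (φ.continuous_normed.mul
      (hg.continuous.comp (continuous_const.sub continuous_id))).integrable_of_hasCompactSupport
      φ.hasCompactSupport_normed.mul_right
  have hlip : LipschitzWith 1 ρ := by
    refine LipschitzWith.of_dist_le_mul fun x y => ?_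
    rw [NNReal.coe_one, one_mul, dist_eq_norm]
    have e : ρ x - ρ y = ∫ t, φ.normed volume t * (g (x - t) - g (y - t)) := by
      simp only [hρ, convolution, ContinuousLinearMap.lsmul_apply, smul_eq_mul]
      rw [← integral_sub (hi x) (hi y)]
      simp only [mul_sub]
    rw [e]
    calc _ ≤ ∫ t, φ.normed volume t * dist x y := by
          refine norm_integral_le_of_norm_le (φ.integrable_normed.mul_const _)
            (Eventually.of_forall fun t => ?_)
          rw [norm_mul, Real.norm_of_nonneg (φ.nonneg_normed t), ← dist_eq_norm]
          refine mul_le_mul_of_nonneg_left ?_ (φ.nonneg_normed t)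
          have := hg.dist_le_mul (x - t) (y - t)
          rwa [NNReal.coe_one, one_mul, dist_sub_right] at this
      _ = dist x y := by rw [integral_mul_const, φ.integral_normed, one_mul]
  refine ⟨ρ, φ.hasCompactSupport_normed.contDiff_convolution_left _ hφ
    hg.continuous.locallyIntegrable, fun z => ?_, fun z => ?_⟩
  · rw [← Real.dist_eq]
    refine φ.dist_normed_convolution_le hg.continuous.aestronglyMeasurable fun w hw => ?_
    have := hg.dist_le_mul w z
    rw [NNReal.coe_one, one_mul] at this
    exact this.trans (le_of_lt hw)
  · simpa using norm_fderiv_le_of_lipschitz ℝ hlip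

/-- The logarithmic cutoff: `0` for `t ≤ e`, `1` for `t ≥ exp (-√(log (1/e)))`, with derivative
of order `1 / (t log (1/t) log log (1/e))`. -/
lemma exists_log_cutoff : ∃ σ : ℝ, 0 < σ ∧ ∀ e : ℝ, 0 < e → 1 < -Real.log e →
    ∃ H : ℝ → ℝ, ContDiff ℝ ∞ H ∧ (∀ t, 0 ≤ H t ∧ H t ≤ 1) ∧ (∀ t ≤ e, H t = 0) ∧
      (∀ t, Real.exp (-√(-Real.log e)) ≤ t → H t = 1) ∧
      ∀ t, deriv H t ≠ 0 → e ≤ t ∧ t ≤ Real.exp (-√(-Real.log e)) ∧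
        |deriv H t| ≤ σ / (Real.log (-Real.log e) * (t * -Real.log t)) := by
  obtain ⟨σ, hσ0, hσ⟩ := exists_bound_mul_deriv_smoothTransition
  refine ⟨2 * σ + 1, by positivity, fun e he hl => ?_⟩
  set l := -Real.log e with hldef
  set s := Real.exp (-√l) with hs
  set L := Real.log l with hL
  have hL0 : 0 < L := Real.log_pos hl
  have hsq : 1 < √l := by rw [Real.lt_sqrt (by norm_num)]; linarith
  have hs1 : s < 1 := by rw [hs, Real.exp_lt_one_iff]; linarith
  have hsql : √l < l := by
    nlinarith [Real.sq_sqrt (show 0 ≤ l by linarith)]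
  have hes : e < s := by
    rw [← Real.exp_log he, hs]
    exact Real.exp_lt_exp.2 (by linarith)
  -- Normalised so that `a(e) = 0` and, since `log √l = L/2`, `a(s) = 1`. Its derivative is `2 / (L
  -- t (-log t))`.
  set a : ℝ → ℝ := fun t => 2 - 2 * Real.log (-Real.log t) / L with ha
  set H : ℝ → ℝ := fun t => if t ≤ e then 0 else if t < s then Real.smoothTransition (a t) else 1
    with hH
  have hneg : ∀ t, 0 < t → t < 1 → 0 < -Real.log t := fun t h0 h1 => by
    have := Real.log_neg h0 h1; linarith
  have ha0 : ∀ t, 0 < t → t ≤ e → a t ≤ 0 := by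
    intro t h0 h1
    have h2 : l ≤ -Real.log t := by rw [hldef]; exact neg_le_neg (Real.log_le_log h0 h1)
    have h3 : L ≤ Real.log (-Real.log t) := Real.log_le_log (by linarith) h2
    have h4 : 2 ≤ 2 * Real.log (-Real.log t) / L := by rw [le_div_iff₀ hL0]; linarith
    simp only [ha]; linarith
  have ha1 : ∀ t, s ≤ t → t < 1 → 1 ≤ a t := by
    intro t h0 h1
    have ht0 : 0 < t := (Real.exp_pos _).trans_le h0
    have h2 : -Real.log t ≤ √l := by
      have := Real.log_le_log (Real.exp_pos _) h0
      rw [Real.log_exp] at this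
      linarith
    have h3 : Real.log (-Real.log t) ≤ L / 2 := by
      have := Real.log_le_log (hneg t ht0 h1) h2
      rwa [Real.log_sqrt (by linarith)] at this
    have h4 : 2 * Real.log (-Real.log t) / L ≤ 1 := by rw [div_le_one hL0]; linarith
    simp only [ha]; linarith
  have hmid : ∀ t, 0 < t → t < 1 → H t = Real.smoothTransition (a t) := by
    intro t h0 h1
    simp only [hH]
    split_ifs with c1 c2
    · exact (Real.smoothTransition.zero_of_nonpos (ha0 t h0 c1)).symm
    · rfl
    · exact (Real.smoothTransition.one_of_one_le (ha1 t (not_lt.1 c2) h1)).symm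
  have hHe : ∀ t ≤ e, H t = 0 := fun t ht => by simp only [hH]; rw [if_pos ht]
  have hHs : ∀ t, s ≤ t → H t = 1 := fun t ht => by
    simp only [hH]; rw [if_neg (by linarith), if_neg (by linarith)]
  have ev0 : ∀ t, t < e → H =ᶠ[𝓝 t] fun _ => 0 := fun t ht => by
    filter_upwards [gt_mem_nhds ht] with u hu
    exact hHe u (le_of_lt hu)
  have ev1 : ∀ t, s < t → H =ᶠ[𝓝 t] fun _ => 1 := fun t ht => by
    filter_upwards [lt_mem_nhds ht] with u hu
    exact hHs u (le_of_lt hu)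
  have evm : ∀ t, 0 < t → t < 1 → H =ᶠ[𝓝 t] fun t => Real.smoothTransition (a t) := fun t h0 h1 => by
    filter_upwards [lt_mem_nhds h0, gt_mem_nhds h1] with u hu0 hu1
    exact hmid u hu0 hu1
  refine ⟨H, ?_, ?_, hHe, hHs, ?_⟩
  · rw [contDiff_iff_contDiffAt]
    intro t
    by_cases c1 : t < e
    · exact contDiffAt_const.congr_of_eventuallyEq (ev0 t c1)
    by_cases c2 : s < t
    · exact contDiffAt_const.congr_of_eventuallyEq (ev1 t c2)
    push Not at c1 c2
    have h0 : 0 < t := by linarith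
    have h1 : t < 1 := by linarith
    refine ContDiffAt.congr_of_eventuallyEq ?_ (evm t h0 h1)
    refine Real.smoothTransition.contDiffAt.comp t ?_
    have hlog : ContDiffAt ℝ ∞ Real.log t := Real.contDiffAt_log.2 h0.ne'
    exact contDiffAt_const.sub ((contDiffAt_const.mul
      (hlog.neg.log (hneg t h0 h1).ne')).div_const _)
  · intro t
    simp only [hH]
    split_ifs
    · norm_num
    · exact ⟨Real.smoothTransition.nonneg _, Real.smoothTransition.le_one _⟩
    · norm_num
  · intro t ht
    have c1 : e ≤ t := by
      by_contra! c
      exact ht (by rw [(ev0 t c).deriv_eq]; simp)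
    have c2 : t ≤ s := by
      by_contra! c
      exact ht (by rw [(ev1 t c).deriv_eq]; simp)
    have h0 : 0 < t := by linarith
    have h1 : t < 1 := by linarith
    have hn := hneg t h0 h1
    refine ⟨c1, c2, ?_⟩
    have d1 : HasDerivAt (fun t => Real.log (-Real.log t)) (-t⁻¹ / -Real.log t) t :=
      (Real.hasDerivAt_log h0.ne').neg.log hn.ne'
    have d2 : HasDerivAt a (-(2 * (-t⁻¹ / -Real.log t) / L)) t :=
      ((d1.const_mul 2).div_const L).const_sub 2
    have d3 : HasDerivAt (fun t => Real.smoothTransition (a t)) _ t :=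
      (((Real.smoothTransition.contDiff (n := 1)).differentiable (by simp) (a t)).hasDerivAt).comp
        t d2
    rw [(evm t h0 h1).deriv_eq, d3.deriv, abs_mul]
    have e1 : |-(2 * (-t⁻¹ / -Real.log t) / L)| = 2 / (L * (t * -Real.log t)) := by
      have : -(2 * (-t⁻¹ / -Real.log t) / L) = 2 / (L * (t * -Real.log t)) := by
        field_simp
      rw [this, abs_of_nonneg (by positivity)]
    rw [e1]
    calc _ ≤ σ * (2 / (L * (t * -Real.log t))) := by
          gcongr
          exact (hσ _).2
      _ = 2 * σ / (L * (t * -Real.log t)) := by ring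
      _ ≤ _ := by gcongr; linarith

/-! ### Transplanting a field from one open set to another. -/

/-- Leibniz rule, by testing the equation on the plane with `χφ`. Because the equation is global,
`B` need not be related to the set where `V` originated. -/
lemma HasWeakDbar.smooth_mul {V ν χ : ℂ → ℂ} (hV : Continuous V) (hν : Measurable ν) {M : ℝ}
    (hM : ∀ z, ‖ν z‖ ≤ M) (hw : HasWeakDbar Set.univ V ν) (hχ : ContDiff ℝ ∞ χ) (B : Set ℂ) :
    HasWeakDbar B (fun z => χ z * V z) (fun z => χ z * ν z + V z * dbar χ z) := by
  intro φ hφ hφc hφB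
  have hz : ∀ z ∉ B, φ z = 0 ∧ dbar φ z = 0 := fun z hz =>
    ⟨image_eq_zero_of_notMem_tsupport fun h => hz (hφB h), by
      by_contra h; exact hz (hφB (support_dbar_subset φ h))⟩
  rw [setIntegral_eq_integral_of_forall_compl_eq_zero fun z h => by rw [(hz z h).2, mul_zero],
    setIntegral_eq_integral_of_forall_compl_eq_zero fun z h => by rw [(hz z h).1, mul_zero]]
  have h := hw (fun z => χ z * φ z) (hχ.mul hφ) hφc.mul_left (Set.subset_univ _)
  rw [Measure.restrict_univ] at h
  have i1 : Integrable fun z => χ z * V z * dbar φ z :=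
    ((hχ.continuous.mul hV).mul (continuous_dbar hφ)).integrable_of_hasCompactSupport
      (hasCompactSupport_dbar hφc).mul_left
  have i2 : Integrable fun z => V z * dbar χ z * φ z :=
    ((hV.mul (continuous_dbar hχ)).mul hφ.continuous).integrable_of_hasCompactSupport hφc.mul_left
  have i3 : Integrable fun z => ν z * (χ z * φ z) :=
    ((hχ.mul hφ).continuous.integrable_of_hasCompactSupport hφc.mul_left).bdd_mul
      hν.aestronglyMeasurable (Eventually.of_forall hM)
  have e1 : ∫ z, V z * dbar (fun z => χ z * φ z) z =
      (∫ z, χ z * V z * dbar φ z) + ∫ z, V z * dbar χ z * φ z := by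
    rw [← integral_add i1 i2]
    refine integral_congr_ae (Eventually.of_forall fun z => ?_)
    simp only
    rw [dbar_mul (hχ.differentiable (by simp) z) (hφ.differentiable (by simp) z)]
    ring
  have e2 : ∫ z, (χ z * ν z + V z * dbar χ z) * φ z =
      (∫ z, ν z * (χ z * φ z)) + ∫ z, V z * dbar χ z * φ z := by
    rw [← integral_add i3 i2]
    refine integral_congr_ae (Eventually.of_forall fun z => ?_)
    simp only
    ring
  rw [e2]
  linear_combination h - e1

/-- Extension by zero of a Teichmüller field to the plane. -/
lemma IsTeichmullerField.exists_extension {A : Set ℂ} (hA : IsOpen A) {z : ℂ} (hz : z ∈ A)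
    {V μ : ℂ → ℂ} (h : IsTeichmullerField A z V) (hw : HasWeakDbar A V μ)
    (hμ : MemLp μ ∞ (volume.restrict A)) :
    ∃ V₀ ν : ℂ → ℂ, Continuous V₀ ∧ (∀ w ∉ A, V₀ w = 0) ∧ V₀ z = 1 ∧
      Tendsto (fun w => V₀ w / w ^ 2) (Bornology.cobounded ℂ) (𝓝 0) ∧
      Measurable ν ∧ (∀ w, ‖ν w‖ ≤ (eLpNorm μ ∞ (volume.restrict A)).toReal) ∧
      HasWeakDbar Set.univ V₀ ν := by
  set M := (eLpNorm μ ∞ (volume.restrict A)).toReal with hM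
  set V₀ : ℂ → ℂ := A.indicator V with hV₀
  have hVc : Continuous V₀ := by
    classical
    exact continuous_indicator h.map_frontier h.continuousOn
  have hV0 : ∀ w ∉ A, V₀ w = 0 := fun w hw => Set.indicator_of_notMem hw V
  have hVA : ∀ w ∈ A, V₀ w = V w := fun w hw => Set.indicator_of_mem hw V
  have hw₀ : HasWeakDbar A V₀ μ := by
    intro φ hφ hφc hφA
    rw [← hw φ hφ hφc hφA]
    exact setIntegral_congr_fun hA.measurableSet fun w hw => by rw [hVA w hw]
  have hbd : ∀ᵐ w ∂(volume.restrict A), ‖μ w‖ ≤ M := by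
    have h1 := ae_le_eLpNormEssSup (f := μ) (μ := volume.restrict A)
    rw [← eLpNorm_exponent_top] at h1
    filter_upwards [h1] with w hw1
    rw [hM, ← ENNReal.ofReal_le_iff_le_toReal hμ.2.ne, ofReal_norm]
    exact hw1
  obtain ⟨ν, hν, hνM, hνw⟩ := exists_hasWeakDbar_univ hA hVc hV0 hw₀ ENNReal.toReal_nonneg hμ.1 hbd
  refine ⟨V₀, ν, hVc, hV0, by rw [hVA z hz, h.map_point], ?_, hν, hνM, hνw⟩
  rw [Metric.tendsto_nhds]
  intro ε hε
  have h1 := Metric.tendsto_nhds.1 h.map_infty ε hε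
  rw [eventually_inf_principal] at h1
  filter_upwards [h1] with w hw1
  by_cases hwA : w ∈ A
  · rw [hVA w hwA]; exact hw1 hwA
  · rw [hV0 w hwA, zero_div, dist_self]; exact hε

/-- Cutting off a Teichmüller field of `A` near `∂A` gives a competitor for any open set whose
boundary is close to that of `A`. -/
theorem exists_competitor : ∃ C : ℝ, 0 < C ∧ ∀ (A B : Set ℂ) (ε a₀ R₀ : ℝ) (w : ℂ) (V μ : ℂ → ℂ),
    IsOpen A → 0 < ε → (frontier A).Nonempty →
    (∀ z ∈ frontier B, Metric.infDist z (frontier A) ≤ ε) →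
    (∀ ζ₀ ∈ frontier A, ∃ ζ₁ ∈ frontier A, a₀ ≤ ‖ζ₁ - ζ₀‖ ∧ ‖ζ₁ - ζ₀‖ ≤ R₀) →
    1 < -Real.log (4 * ε) →
    5 * Real.exp (-√(-Real.log (4 * ε))) ≤ 2 * a₀ →
    6 * R₀ * Real.exp (-√(-Real.log (4 * ε))) ≤ 1 →
    w ∈ A → Real.exp (-√(-Real.log (4 * ε))) + ε ≤ Metric.infDist w (frontier A) →
    IsTeichmullerField A w V → HasWeakDbar A V μ → MemLp μ ∞ (volume.restrict A) →
    ∃ V' μ' : ℂ → ℂ, IsTeichmullerField B w V' ∧ HasWeakDbar B V' μ' ∧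
      MemLp μ' ∞ (volume.restrict B) ∧
      (eLpNorm μ' ∞ (volume.restrict B)).toReal ≤
        (eLpNorm μ ∞ (volume.restrict A)).toReal * (1 + C / Real.log (-Real.log (4 * ε))) := by
  obtain ⟨σ, hσ0, hcut⟩ := exists_log_cutoff
  set κ := volume.real (Metric.ball (0 : ℂ) 1) with hκ
  have hκ0 : 0 ≤ κ := measureReal_nonneg
  have hc0 := cauchyConst_pos
  refine ⟨225 * σ * κ / cauchyConst + 1, by positivity, ?_⟩
  intro A B ε a₀ R₀ w V μ hA hε hFne hBF hζ hl hsa hsR hwA hwd hV hweak hμ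
  obtain ⟨V₀, ν, hVc, hV0, hVw, hVinf, hν, hνM, hνw⟩ := hV.exists_extension hA hwA hweak hμ
  set M := (eLpNorm μ ∞ (volume.restrict A)).toReal with hM
  have hM0 : 0 ≤ M := ENNReal.toReal_nonneg
  -- The smoothed distance errs by at most `ε`. The threshold `4ε` covers `∂B`, where it is at most
  -- `2ε`, and makes the error at most a quarter of `ρ` wherever `H'` is nonzero.
  obtain ⟨H, hHs, hH01, hHe, hHs1, hHd⟩ := hcut (4 * ε) (by positivity) hl
  set s := Real.exp (-√(-Real.log (4 * ε))) with hs
  set L := Real.log (-Real.log (4 * ε)) with hL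
  have hL0 : 0 < L := Real.log_pos hl
  set F := frontier A with hF
  obtain ⟨ρ, hρs, hρd, hρ1⟩ := exists_smooth_lipschitz_approx (Metric.lipschitz_infDist_pt F) hε
  set χ : ℂ → ℂ := fun z => (H (ρ z) : ℂ) with hχ
  have hχs : ContDiff ℝ ∞ χ := Complex.ofRealCLM.contDiff.comp (hHs.comp hρs)
  have hχ1 : ∀ z, ‖χ z‖ ≤ 1 := fun z => by
    simp only [hχ, Complex.norm_real, Real.norm_of_nonneg (hH01 _).1]
    exact (hH01 _).2
  have hχd : ∀ z, ‖dbar χ z‖ ≤ |deriv H (ρ z)| := fun z => by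
    refine (norm_dbar_le_norm_fderiv χ z).trans ?_
    have d1 : HasFDerivAt (fun z => H (ρ z)) _ z :=
      ((hHs.differentiable (by simp) (ρ z)).hasDerivAt).comp_hasFDerivAt z
        (hρs.differentiable (by simp) z).hasFDerivAt
    have d2 : HasFDerivAt χ _ z := Complex.ofRealCLM.hasFDerivAt.comp z d1
    rw [d2.fderiv]
    refine (ContinuousLinearMap.opNorm_comp_le _ _).trans ?_
    rw [Complex.ofRealCLM_norm, one_mul, norm_smul, Real.norm_eq_abs]
    exact mul_le_of_le_one_right (abs_nonneg _) (hρ1 z)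
  have hprod : ∀ z, ‖V₀ z * dbar χ z‖ ≤ M * (225 * σ * κ / cauchyConst / L) := by
    intro z
    by_cases hd : deriv H (ρ z) = 0
    · have h0 : dbar χ z = 0 := by
        have := hχd z
        rw [hd, abs_zero] at this
        exact norm_le_zero_iff.1 this
      rw [h0, mul_zero, norm_zero]
      positivity
    obtain ⟨ht1, ht2, ht3⟩ := hHd _ hd
    set t := ρ z with ht
    have ht0 : 0 < t := by linarith
    obtain ⟨ζ₀, hζ₀, hdist⟩ := isClosed_frontier.exists_infDist_eq_dist hFne z
    obtain ⟨ζ₁, hζ₁, ha1, ha2⟩ := hζ ζ₀ hζ₀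
    have hr := abs_le.1 (hρd z)
    rw [hdist, dist_eq_norm] at hr
    set r := ‖z - ζ₀‖ with hrdef
    have hr1 : 3 / 4 * t ≤ r := by linarith
    have hr2 : r ≤ 5 / 4 * t := by linarith
    have hr0 : 0 < r := by linarith
    have hFA : ∀ ζ ∈ F, V₀ ζ = 0 := fun ζ hζ => hV0 ζ fun h => by
      rw [hF, hA.frontier_eq] at hζ; exact hζ.2 h
    have hest := norm_le_of_vanish hVc hν hνM hνw hVinf (hFA ζ₀ hζ₀) (hFA ζ₁ hζ₁) hr0
      (by linarith)
    set a := ‖ζ₁ - ζ₀‖ with ha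
    have ha0 : 0 < a := by linarith
    have hlt : 0 < -Real.log t := by
      have h1 : s < 1 := by
        rw [hs, Real.exp_lt_one_iff, neg_lt_zero]; exact Real.sqrt_pos.2 (by linarith)
      have := Real.log_neg ht0 (by linarith)
      linarith
    -- From `a ≤ R₀` and `r ≥ 3t/4` one gets `4a/r ≤ 16R₀/(3t) ≤ 1/t²`, as `6R₀t ≤ 1`. So the
    -- diameter enters only through the smallness of `ε`, not through the constant.
    have hlog : Real.log (4 * a / r) ≤ 2 * -Real.log t := by
      have h1 : 4 * a / r ≤ (t * t)⁻¹ := by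
        rw [div_le_iff₀ hr0, inv_mul_eq_div, le_div_iff₀ (by positivity)]
        have h2 : 6 * R₀ * t ≤ 1 := le_trans (by gcongr; linarith) hsR
        nlinarith
      have := Real.log_le_log (by positivity) h1
      rw [Real.log_inv, Real.log_mul ht0.ne' ht0.ne'] at this
      linarith
    -- `225 = 90 · (5/4) · 2`, from `norm_le_of_vanish`, `r ≤ 5t/4` and the bound on the logarithm.
    have hV1 : ‖V₀ z‖ ≤ 225 * κ / cauchyConst * M * (t * -Real.log t) := by
      have : cauchyConst * ‖V₀ z‖ ≤ 90 * κ * M * (5 / 4 * t * (2 * -Real.log t)) := by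
        refine hest.trans ?_
        have : 0 ≤ Real.log (4 * a / r) := Real.log_nonneg (by
          rw [le_div_iff₀ hr0]; linarith)
        gcongr
      rw [← le_div_iff₀' hc0] at this
      refine this.trans (le_of_eq ?_)
      field_simp
      ring
    rw [norm_mul]
    have hlt' : Real.log t ≠ 0 := by linarith
    calc ‖V₀ z‖ * ‖dbar χ z‖ ≤ (225 * κ / cauchyConst * M * (t * -Real.log t)) *
          (σ / (L * (t * -Real.log t))) := by
          gcongr
          exact (hχd z).trans ht3
      _ = _ := by field_simp
  have hbound : ∀ z, ‖χ z * ν z + V₀ z * dbar χ z‖ ≤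
      M * (1 + (225 * σ * κ / cauchyConst + 1) / L) := by
    intro z
    calc _ ≤ ‖χ z‖ * ‖ν z‖ + ‖V₀ z * dbar χ z‖ := by
          rw [← norm_mul]; exact norm_add_le _ _
      _ ≤ 1 * M + M * (225 * σ * κ / cauchyConst / L) := by
          gcongr
          · exact hχ1 z
          · exact hνM z
          · exact hprod z
      _ ≤ _ := by
          have : 0 ≤ M / L := by positivity
          have e : M * (1 + (225 * σ * κ / cauchyConst + 1) / L) =
            1 * M + M * (225 * σ * κ / cauchyConst / L) + M / L := by ring
          linarith
  have hbound0 : 0 ≤ M * (1 + (225 * σ * κ / cauchyConst + 1) / L) := by positivity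
  have hmeas : Measurable fun z => χ z * ν z + V₀ z * dbar χ z := by
    have h1 := hχs.continuous.measurable
    have h2 := hVc.measurable
    have h3 := (continuous_dbar hχs).measurable
    fun_prop
  refine ⟨fun z => χ z * V₀ z, fun z => χ z * ν z + V₀ z * dbar χ z, ⟨?_, ?_, ?_, ?_⟩,
    hνw.smooth_mul hVc hν hνM hχs B, ?_, ?_⟩
  · exact (hχs.continuous.mul hVc).continuousOn
  · have h1 : s ≤ ρ w := by have := abs_le.1 (hρd w); linarith
    simp only [hχ]
    rw [hHs1 _ h1, hVw, Complex.ofReal_one, one_mul]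
  · intro ζ hζB
    have h1 : ρ ζ ≤ 4 * ε := by
      have := abs_le.1 (hρd ζ)
      have := hBF ζ hζB
      linarith
    simp only [hχ]
    rw [hHe _ h1, Complex.ofReal_zero, zero_mul]
  · have h1 : Tendsto (fun w => χ w * V₀ w / w ^ 2) (Bornology.cobounded ℂ) (𝓝 0) := by
      refine squeeze_zero_norm (fun u => ?_) (by simpa only [norm_zero] using hVinf.norm)
      rw [mul_div_assoc, norm_mul]
      exact mul_le_of_le_one_left (norm_nonneg _) (hχ1 u)
    exact h1.mono_left inf_le_left
  · exact memLp_top_of_bound hmeas.aestronglyMeasurable _ (Eventually.of_forall hbound)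
  · refine ENNReal.toReal_le_of_le_ofReal hbound0 ?_
    rw [eLpNorm_exponent_top]
    exact eLpNormEssSup_le_of_ae_bound (Eventually.of_forall hbound)

/-! ### Connectedness and boundaries. -/

/-- A preconnected set meeting an open set but not its boundary lies in the open set. -/
lemma IsPreconnected.subset_of_disjoint_frontier {S A : Set ℂ} (hS : IsPreconnected S)
    (hA : IsOpen A) (hSA : (S ∩ A).Nonempty) (hd : ∀ x ∈ S, x ∉ frontier A) : S ⊆ A := by
  have hcover : S ⊆ A ∪ (closure A)ᶜ := by
    intro x hx
    by_contra h
    rw [Set.mem_union, not_or, Set.mem_compl_iff, not_not] at h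
    exact hd x hx (by rw [hA.frontier_eq]; exact ⟨h.2, h.1⟩)
  refine hS.subset_left_of_subset_union hA isClosed_closure.isOpen_compl ?_ hcover hSA
  exact Set.disjoint_left.2 fun x hx hx' => hx' (subset_closure hx)

lemma closedBall_subset_of_lt_infDist {A : Set ℂ} (hA : IsOpen A) {w : ℂ} (hw : w ∈ A) {r : ℝ}
    (hr0 : 0 ≤ r) (hr : r < Metric.infDist w (frontier A)) : Metric.closedBall w r ⊆ A := by
  refine (convex_closedBall w r).isPreconnected.subset_of_disjoint_frontier hA
    ⟨w, Metric.mem_closedBall_self hr0, hw⟩ fun x hx hxF => ?_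
  have := Metric.infDist_le_dist_of_mem (x := w) hxF
  rw [Metric.mem_closedBall, dist_comm] at hx
  linarith

/-- A compact subset of a domain can be joined to a base point at a positive distance from a closed
set not meeting the domain. -/
lemma exists_uniform_joining {U F K : Set ℂ} (hU : IsOpen U) (hUc : IsConnected U)
    (hF : IsClosed F) (hFne : F.Nonempty) (hUF : ∀ x ∈ U, x ∉ F) (hK : IsCompact K) (hKU : K ⊆ U)
    {z₀ : ℂ} (hz₀ : z₀ ∈ U) :
    ∃ δ : ℝ, 0 < δ ∧ ∀ x ∈ K, ∃ T : Set ℂ, IsPreconnected T ∧ z₀ ∈ T ∧ x ∈ T ∧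
      ∀ y ∈ T, δ ≤ Metric.infDist y F := by
  refine hK.induction_on (p := fun K => ∃ δ : ℝ, 0 < δ ∧ ∀ x ∈ K, ∃ T : Set ℂ, IsPreconnected T ∧
    z₀ ∈ T ∧ x ∈ T ∧ ∀ y ∈ T, δ ≤ Metric.infDist y F) ⟨1, one_pos, by simp⟩ ?_ ?_ ?_
  · rintro s t hst ⟨δ, hδ, h⟩
    exact ⟨δ, hδ, fun x hx => h x (hst hx)⟩
  · rintro s t ⟨δ, hδ, h⟩ ⟨δ', hδ', h'⟩
    refine ⟨min δ δ', lt_min hδ hδ', fun x hx => ?_⟩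
    rcases hx with hx | hx
    · obtain ⟨T, h1, h2, h3, h4⟩ := h x hx
      exact ⟨T, h1, h2, h3, fun y hy => (min_le_left _ _).trans (h4 y hy)⟩
    · obtain ⟨T, h1, h2, h3, h4⟩ := h' x hx
      exact ⟨T, h1, h2, h3, fun y hy => (min_le_right _ _).trans (h4 y hy)⟩
  · intro x hx
    obtain ⟨r, hr, hball⟩ := Metric.isOpen_iff.1 hU x (hKU hx)
    obtain ⟨γ, hγ⟩ := (hU.isConnected_iff_isPathConnected.1 hUc).joinedIn z₀ hz₀ x (hKU hx)
    -- One path to `x` followed by a small ball serves all points near `x` at once, so the lower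
    -- bound on the distance is locally uniform and compactness applies.
    set T := Set.range γ ∪ Metric.closedBall x (r / 2) with hT
    have hTU : T ⊆ U := by
      rintro y (⟨t, rfl⟩ | hy)
      · exact hγ t
      · exact hball (Metric.closedBall_subset_ball (by linarith) hy)
    have hTc : IsCompact T := (isCompact_range γ.continuous).union (isCompact_closedBall _ _)
    have hxT : x ∈ Set.range γ := ⟨1, γ.target⟩
    have hTp : IsPreconnected T :=
      (isPreconnected_range γ.continuous).union x hxT
        (Metric.mem_closedBall_self (by positivity)) (convex_closedBall x _).isPreconnected
    have hz₀T : z₀ ∈ T := Or.inl ⟨0, γ.source⟩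
    obtain ⟨y₀, hy₀, hmin⟩ := hTc.exists_isMinOn ⟨z₀, hz₀T⟩
      (Metric.continuous_infDist_pt F).continuousOn
    refine ⟨Metric.ball x (r / 2), mem_nhdsWithin_of_mem_nhds (Metric.ball_mem_nhds x (by positivity)),
      Metric.infDist y₀ F, (hF.notMem_iff_infDist_pos hFne).1 (hUF _ (hTU hy₀)), fun y hy => ?_⟩
    exact ⟨T, hTp, hz₀T, Or.inr (Metric.ball_subset_closedBall hy), fun u hu => hmin hu⟩

/-- Otherwise the whole ray, being connected and missing the boundary, would stay in the bounded set
`U`. -/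
lemma exists_frontier_on_ray {U : Set ℂ} (hU : IsOpen U) (hb : Bornology.IsBounded U) {u : ℂ}
    (hu : u ∈ U) {v : ℝ} (hv : v ≠ 0) : ∃ t : ℝ, 0 < t ∧ u + (t * v : ℝ) ∈ frontier U := by
  by_contra! h
  set S : Set ℂ := (fun t : ℝ => u + (t * v : ℝ)) '' Set.Ici 0 with hS
  have hSp : IsPreconnected S := by
    have : Continuous fun t : ℝ => u + ((t * v : ℝ) : ℂ) := by fun_prop
    exact isPreconnected_Ici.image _ this.continuousOn
  have hSU : S ⊆ U := by
    refine hSp.subset_of_disjoint_frontier hU ⟨u, ⟨0, by simp, by simp⟩, hu⟩ ?_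
    rintro _ ⟨t, ht, rfl⟩ hf
    rcases (show (0 : ℝ) ≤ t from ht).eq_or_lt with h0 | h0
    · rw [hU.frontier_eq] at hf
      apply hf.2
      simpa [← h0] using hu
    · exact h t h0 hf
  obtain ⟨R, hR⟩ := hb.subset_closedBall u
  have hR0 : 0 ≤ R := by
    have := hR hu
    simpa using this
  have hmem := hR (hSU ⟨(R + 1) / |v|, by simp only [Set.mem_Ici]; positivity, rfl⟩)
  rw [Metric.mem_closedBall, dist_eq_norm, add_sub_cancel_left, Complex.norm_real, Real.norm_eq_abs,
    abs_mul, abs_div, abs_abs, div_mul_cancel₀ _ (abs_ne_zero.2 hv), abs_of_nonneg (by linarith)]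
    at hmem
  linarith

/-- The boundary of a bounded nonempty open set contains two points. -/
lemma exists_ne_mem_frontier {U : Set ℂ} (hU : IsOpen U) (hb : Bornology.IsBounded U)
    (hne : U.Nonempty) : ∃ x ∈ frontier U, ∃ y ∈ frontier U, x ≠ y := by
  obtain ⟨u, hu⟩ := hne
  obtain ⟨t, ht, h1⟩ := exists_frontier_on_ray hU hb hu one_ne_zero
  obtain ⟨t', ht', h2⟩ := exists_frontier_on_ray hU hb hu (neg_ne_zero.2 one_ne_zero)
  refine ⟨_, h1, _, h2, fun h => ?_⟩
  have := Complex.ofReal_injective (add_left_cancel h)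
  linarith

/-! ### Comparison of densities. -/

/-- The set of norms over which `teichmullerDensity` is the infimum. -/
def teichmullerNorms (A : Set ℂ) (z : ℂ) : Set ℝ :=
  {M : ℝ | ∃ V μ : ℂ → ℂ, IsTeichmullerField A z V ∧ HasWeakDbar A V μ ∧
    MemLp μ ∞ (volume.restrict A) ∧ M = (eLpNorm μ ∞ (volume.restrict A)).toReal}

lemma bddBelow_teichmullerNorms (A : Set ℂ) (z : ℂ) : BddBelow (teichmullerNorms A z) := by
  refine ⟨0, ?_⟩
  rintro M ⟨V, μ, -, -, -, rfl⟩
  exact ENNReal.toReal_nonneg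

/-- A bump function shows that the density is bounded in terms of the distance to the boundary. -/
lemma exists_teichmullerDensity_bound {r : ℝ} (hr : 0 < r) : ∃ Λ : ℝ, 0 ≤ Λ ∧
    ∀ (A : Set ℂ) (z : ℂ), IsOpen A → Metric.closedBall z r ⊆ A →
      (teichmullerNorms A z).Nonempty ∧ teichmullerDensity A z ≤ Λ := by
  let f : ContDiffBump (0 : ℂ) := ⟨r / 2, r, by positivity, by linarith⟩
  have hf : ContDiff ℝ ∞ f := f.contDiff
  obtain ⟨Λ, hΛ⟩ := (f.hasCompactSupport.fderiv ℝ).exists_bound_of_continuous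
    (hf.continuous_fderiv (by simp))
  have hΛ0 : 0 ≤ Λ := (norm_nonneg _).trans (hΛ 0)
  refine ⟨Λ, hΛ0, fun A z hA hzA => ?_⟩
  set V : ℂ → ℂ := fun w => (f (w - z) : ℂ) with hV
  have hVs : ContDiff ℝ ∞ V :=
    Complex.ofRealCLM.contDiff.comp (hf.comp (contDiff_id.sub contDiff_const))
  have hV0 : ∀ w, w ∉ Metric.closedBall z r → V w = 0 := by
    intro w hw
    rw [Metric.mem_closedBall, not_le] at hw
    simp only [hV]
    rw [f.zero_of_le_dist (by rw [dist_zero_right, ← dist_eq_norm]; exact hw.le),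
      Complex.ofReal_zero]
  have hd : ∀ w, ‖dbar V w‖ ≤ Λ := fun w => by
    refine (norm_dbar_le_norm_fderiv V w).trans ?_
    have h1 : HasFDerivAt (fun w : ℂ => w - z) _ w := (hasFDerivAt_id (𝕜 := ℝ) w).sub_const z
    have h1' := HasFDerivAt.comp (g := (f : ℂ → ℝ)) (f := fun w : ℂ => w - z) w
      (hf.differentiable (by simp) (w - z)).hasFDerivAt h1
    have h2 : HasFDerivAt V _ w := Complex.ofRealCLM.hasFDerivAt.comp w h1'
    rw [h2.fderiv]
    refine (ContinuousLinearMap.opNorm_comp_le _ _).trans ?_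
    rw [Complex.ofRealCLM_norm, one_mul, ContinuousLinearMap.comp_id]
    exact hΛ _
  have hmem : (eLpNorm (dbar V) ∞ (volume.restrict A)).toReal ∈ teichmullerNorms A z := by
    refine ⟨V, dbar V, ⟨hVs.continuous.continuousOn, ?_, ?_, ?_⟩, ?_, ?_, rfl⟩
    · simp only [hV]
      rw [sub_self, f.one_of_mem_closedBall (Metric.mem_closedBall_self f.rIn_pos.le),
        Complex.ofReal_one]
    · intro ζ hζ
      refine hV0 ζ fun h => ?_
      rw [hA.frontier_eq] at hζ
      exact hζ.2 (hzA h)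
    · refine (tendsto_const_nhds (x := (0 : ℂ))).congr' ?_
      refine Filter.Eventually.filter_mono inf_le_left ?_
      have : ∀ᶠ w in Bornology.cobounded ℂ, w ∉ Metric.closedBall z r :=
        Bornology.isBounded_def.1 Metric.isBounded_closedBall
      filter_upwards [this] with w hw
      rw [hV0 w hw, zero_div]
    · intro φ hφ hφc hφA
      have hz : ∀ w ∉ A, φ w = 0 ∧ dbar φ w = 0 := fun w hw =>
        ⟨image_eq_zero_of_notMem_tsupport fun h => hw (hφA h), by
          by_contra h; exact hw (hφA (support_dbar_subset φ h))⟩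
      rw [setIntegral_eq_integral_of_forall_compl_eq_zero fun w h => by rw [(hz w h).2, mul_zero],
        setIntegral_eq_integral_of_forall_compl_eq_zero fun w h => by rw [(hz w h).1, mul_zero]]
      exact integral_mul_dbar (hVs.of_le (by simp)) (hφ.of_le (by simp)) hφc
    · exact memLp_top_of_bound (continuous_dbar hVs).aestronglyMeasurable Λ
        (Eventually.of_forall hd)
  refine ⟨⟨_, hmem⟩, (csInf_le (bddBelow_teichmullerNorms A z) hmem).trans ?_⟩
  refine ENNReal.toReal_le_of_le_ofReal hΛ0 ?_
  rw [eLpNorm_exponent_top]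
  exact eLpNormEssSup_le_of_ae_bound (Eventually.of_forall hd)

/-- The densities of two open sets with close boundaries are comparable. -/
theorem exists_teichmullerDensity_le : ∃ C : ℝ, 0 < C ∧ ∀ (A B : Set ℂ) (ε a₀ R₀ : ℝ) (w : ℂ),
    IsOpen A → 0 < ε → (frontier A).Nonempty →
    (∀ z ∈ frontier B, Metric.infDist z (frontier A) ≤ ε) →
    (∀ ζ₀ ∈ frontier A, ∃ ζ₁ ∈ frontier A, a₀ ≤ ‖ζ₁ - ζ₀‖ ∧ ‖ζ₁ - ζ₀‖ ≤ R₀) →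
    1 < -Real.log (4 * ε) →
    5 * Real.exp (-√(-Real.log (4 * ε))) ≤ 2 * a₀ →
    6 * R₀ * Real.exp (-√(-Real.log (4 * ε))) ≤ 1 →
    w ∈ A → Real.exp (-√(-Real.log (4 * ε))) + ε ≤ Metric.infDist w (frontier A) →
    (teichmullerNorms A w).Nonempty →
    teichmullerDensity B w ≤
      teichmullerDensity A w * (1 + C / Real.log (-Real.log (4 * ε))) := by
  obtain ⟨C, hC, h⟩ := exists_competitor
  refine ⟨C, hC, fun A B ε a₀ R₀ w hA hε hF hB hζ hl hs hR hw hd hne => ?_⟩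
  have hL : 0 < Real.log (-Real.log (4 * ε)) := Real.log_pos hl
  have hpos : 0 < 1 + C / Real.log (-Real.log (4 * ε)) := by positivity
  rw [← div_le_iff₀ hpos]
  -- Nonemptiness matters: the real infimum of the empty set is 0 by convention.
  refine le_csInf hne ?_
  rintro M ⟨V, μ, h1, h2, h3, rfl⟩
  obtain ⟨V', μ', q1, q2, q3, q4⟩ := h A B ε a₀ R₀ w V μ hA hε hF hB hζ hl hs hR hw hd h1 h2 h3
  rw [div_le_iff₀ hpos]
  exact (csInf_le (bddBelow_teichmullerNorms B w) ⟨V', μ', q1, q2, q3, rfl⟩).trans q4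

/-! ### Distances between sets and asymptotics in `ε`. -/

lemma infDist_le_of_hausdorffEDist_le {F G : Set ℂ} {ε : ℝ} (hε : 0 ≤ ε)
    (h : Metric.hausdorffEDist F G ≤ ENNReal.ofReal ε) {z : ℂ} (hz : z ∈ F) :
    G.Nonempty ∧ Metric.infDist z G ≤ ε := by
  have h1 := (Metric.infEDist_le_hausdorffEDist_of_mem hz).trans h
  refine ⟨?_, ENNReal.toReal_le_of_le_ofReal hε h1⟩
  by_contra hne
  rw [Set.not_nonempty_iff_eq_empty.1 hne, Metric.infEDist_empty] at h1
  exact ENNReal.ofReal_ne_top (top_le_iff.1 h1)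

lemma setDist_le_infDist {K F : Set ℂ} (hF : F.Nonempty) {w : ℂ} (hw : w ∈ K) :
    setDist K F ≤ Metric.infDist w F := by
  refine (Metric.le_infDist hF).2 fun {y} hy => ?_
  refine csInf_le ⟨0, ?_⟩ ⟨w, hw, y, hy, rfl⟩
  rintro _ ⟨a, _, b, _, rfl⟩
  exact dist_nonneg

lemma setDist_pos {K F : Set ℂ} (hK : IsCompact K) (hKne : K.Nonempty) (hF : IsClosed F)
    (hFne : F.Nonempty) (hd : ∀ x ∈ K, x ∉ F) : 0 < setDist K F := by
  obtain ⟨y₀, hy₀, hmin⟩ := hK.exists_isMinOn hKne (Metric.continuous_infDist_pt F).continuousOn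
  refine ((hF.notMem_iff_infDist_pos hFne).1 (hd _ hy₀)).trans_le ?_
  refine le_csInf (hKne.image2 hFne) ?_
  rintro _ ⟨a, ha, b, hb, rfl⟩
  exact (show Metric.infDist y₀ F ≤ Metric.infDist a F from hmin ha).trans
    (Metric.infDist_le_dist_of_mem hb)

lemma tendsto_neg_log_const_mul : Tendsto (fun ε : ℝ => -Real.log (4 * ε)) (𝓝[>] 0) atTop := by
  rw [tendsto_neg_atTop_iff]
  refine Real.tendsto_log_nhdsGT_zero.comp ?_
  refine tendsto_nhdsWithin_iff.2 ⟨?_, ?_⟩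
  · apply tendsto_nhdsWithin_of_tendsto_nhds
    have : Continuous fun ε : ℝ => 4 * ε := by fun_prop
    simpa using this.tendsto 0
  · filter_upwards [self_mem_nhdsWithin] with ε hε
    exact mul_pos (four_pos (α := ℝ)) hε

/-- It suffices that `log (1/(4ε)) ≥ √(log (1/ε))`, because the logarithm of a square root is half
the logarithm. -/
lemma eventually_half_loglog_le :
    ∀ᶠ ε : ℝ in 𝓝[>] 0, 0 < Real.log (Real.log (1 / ε)) ∧
      Real.log (Real.log (1 / ε)) / 2 ≤ Real.log (-Real.log (4 * ε)) := by
  filter_upwards [tendsto_neg_log_const_mul.eventually_ge_atTop 14, self_mem_nhdsWithin]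
    with ε hl hε
  have h0 : (0 : ℝ) < ε := hε
  rw [Real.log_mul (by norm_num) h0.ne'] at hl ⊢
  have h4 : Real.log 4 ≤ 2 := by
    rw [Real.log_le_iff_le_exp (by norm_num)]
    have := Real.add_one_le_exp (1 : ℝ)
    have h2 : Real.exp 2 = Real.exp 1 * Real.exp 1 := by rw [← Real.exp_add]; norm_num
    nlinarith
  have h40 : 0 ≤ Real.log 4 := Real.log_nonneg (by norm_num)
  rw [one_div, Real.log_inv]
  set y := -Real.log ε with hy
  have hy14 : 14 ≤ y := by linarith
  refine ⟨Real.log_pos (by linarith), ?_⟩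
  rw [← Real.log_sqrt (by linarith)]
  refine Real.log_le_log (Real.sqrt_pos.2 (by linarith)) ?_
  have : √y ≤ y - 2 := by
    rw [Real.sqrt_le_left (by linarith)]
    nlinarith
  linarith

/-! ### The main theorem. -/

theorem theorem1 :
    ∀ d D : ℝ, ∃ C : ℝ, ∀ U K : Set ℂ,
      IsOpen U → IsConnected U → Bornology.IsBounded U →
      IsCompact K → K ⊆ U →
      setDist K (frontier U) = d → Metric.diam U = D →
      ∀ z₀ ∈ U, ∃ ε₀ : ℝ, 0 < ε₀ ∧ ∀ ε : ℝ, 0 < ε → ε < ε₀ →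
        ∀ W : Set ℂ, IsOpen W → IsConnected W →
          Metric.hausdorffEDist (frontier U) (frontier W) ≤ ENNReal.ofReal ε →
          (z₀ ∈ W → K ⊆ W) ∧
          ∀ w ∈ K, w ∈ W →
            |teichmullerDensity U w - teichmullerDensity W w|
              ≤ C * (Real.log (Real.log (1 / ε)))⁻¹ := by
  intro d D
  obtain ⟨C₁, hC₁, hcomp⟩ := exists_teichmullerDensity_le
  by_cases hd : 0 < d
  swap
  -- A nonempty compact `K ⊆ U` is at positive distance from `∂U`, so in this case `K` is empty.
  · refine ⟨0, fun U K hU hUc hUb hK hKU hdK _ z₀ hz₀ => ?_⟩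
    rcases K.eq_empty_or_nonempty with rfl | hKne
    · exact ⟨1, one_pos, fun ε _ _ W _ _ _ => ⟨fun _ => Set.empty_subset _, by simp⟩⟩
    · obtain ⟨x, hx, -⟩ := exists_ne_mem_frontier hU hUb ⟨z₀, hz₀⟩
      refine absurd (hdK ▸ setDist_pos hK hKne isClosed_frontier ⟨x, hx⟩ fun y hy hyF => ?_) hd
      rw [hU.frontier_eq] at hyF
      exact hyF.2 (hKU hy)
  obtain ⟨Λ, hΛ0, hΛ⟩ := exists_teichmullerDensity_bound (show 0 < d / 4 by positivity)
  -- `Λ` depends on `d` alone and `C₁` is absolute; the 2 comes from replacing `log log (1/(4ε))` by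
  -- half of `log log (1/ε)`. The quantities `a₀`, `R₀`, `δ` below affect only `ε₀`.
  refine ⟨2 * Λ * C₁, fun U K hU hUc hUb hK hKU hdK _ z₀ hz₀ => ?_⟩
  obtain ⟨x, hx, y, hy, hxy⟩ := exists_ne_mem_frontier hU hUb ⟨z₀, hz₀⟩
  have hUF : ∀ u ∈ U, u ∉ frontier U := fun u hu huF => by
    rw [hU.frontier_eq] at huF; exact huF.2 hu
  have hb : 0 < ‖x - y‖ := norm_pos_iff.2 (sub_ne_zero.2 hxy)
  obtain ⟨δ, hδ, hjoin⟩ := exists_uniform_joining hU hUc isClosed_frontier ⟨x, hx⟩ hUF hK hKU hz₀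
  obtain ⟨R, hR⟩ := hUb.closure.subset_closedBall 0
  -- A quarter leaves room for `∂W`: points of it within `ε ≤ a₀` of `x` and `y` are still `2a₀`
  -- apart, so one of them is at least `a₀` from any given point.
  set a₀ := ‖x - y‖ / 4 with ha₀
  set R₀ := 2 * (R + 1) with hR₀
  have hid : Tendsto (fun ε : ℝ => ε) (𝓝[>] 0) (𝓝 0) :=
    tendsto_nhdsWithin_of_tendsto_nhds tendsto_id
  have hs : Tendsto (fun ε : ℝ => Real.exp (-√(-Real.log (4 * ε)))) (𝓝[>] 0) (𝓝 0) :=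
    Real.tendsto_exp_neg_atTop_nhds_zero.comp
      (Real.tendsto_sqrt_atTop.comp tendsto_neg_log_const_mul)
  have hev : ∀ᶠ ε : ℝ in 𝓝[>] 0, ε < δ ∧ ε ≤ 1 ∧ ε ≤ a₀ ∧ ε ≤ d / 2 ∧ 1 < -Real.log (4 * ε) ∧
      5 * Real.exp (-√(-Real.log (4 * ε))) ≤ 2 * a₀ ∧
      6 * R₀ * Real.exp (-√(-Real.log (4 * ε))) ≤ 1 ∧
      Real.exp (-√(-Real.log (4 * ε))) + ε ≤ d / 2 ∧
      (0 < Real.log (Real.log (1 / ε)) ∧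
        Real.log (Real.log (1 / ε)) / 2 ≤ Real.log (-Real.log (4 * ε))) := by
    have e5 := (hs.const_mul 5).eventually_le_const (u := 2 * a₀) (by rw [mul_zero]; positivity)
    have e6 := (hs.const_mul (6 * R₀)).eventually_le_const (u := 1) (by rw [mul_zero]; exact one_pos)
    have e7 := (hs.add hid).eventually_le_const (u := d / 2) (by rw [add_zero]; positivity)
    filter_upwards [hid.eventually_lt_const hδ, hid.eventually_le_const one_pos,
      hid.eventually_le_const (show 0 < a₀ by positivity),
      hid.eventually_le_const (show 0 < d / 2 by positivity),
      tendsto_neg_log_const_mul.eventually_gt_atTop 1, e5, e6, e7, eventually_half_loglog_le]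
      with ε h1 h2 h3 h4 h5 h6 h7 h8 h9
    exact ⟨h1, h2, h3, h4, h5, h6, h7, h8, h9⟩
  obtain ⟨ε₀, hε₀, hsub⟩ := mem_nhdsGT_iff_exists_Ioo_subset.1 hev
  refine ⟨ε₀, hε₀, fun ε hε hεε₀ W hW hWc hH => ?_⟩
  obtain ⟨h1, h2, h3, h4, h5, h6, h7, h8, h9, h10⟩ := hsub ⟨hε, hεε₀⟩
  have hUW : ∀ z ∈ frontier U, Metric.infDist z (frontier W) ≤ ε := fun z hz =>
    (infDist_le_of_hausdorffEDist_le hε.le hH hz).2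
  have hWne : (frontier W).Nonempty := (infDist_le_of_hausdorffEDist_le hε.le hH hx).1
  have hWU : ∀ z ∈ frontier W, Metric.infDist z (frontier U) ≤ ε := fun z hz =>
    (infDist_le_of_hausdorffEDist_le hε.le (Metric.hausdorffEDist_comm.trans_le hH) hz).2
  have hWU' : ∀ z ∈ frontier W, ∃ z' ∈ frontier U, ‖z - z'‖ ≤ ε := fun z hz => by
    obtain ⟨z', hz', he⟩ := isClosed_frontier.exists_infDist_eq_dist ⟨x, hx⟩ z
    exact ⟨z', hz', by rw [← dist_eq_norm, ← he]; exact hWU z hz⟩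
  have hUW' : ∀ z ∈ frontier U, ∃ z' ∈ frontier W, ‖z - z'‖ ≤ ε := fun z hz => by
    obtain ⟨z', hz', he⟩ := isClosed_frontier.exists_infDist_eq_dist hWne z
    exact ⟨z', hz', by rw [← dist_eq_norm, ← he]; exact hUW z hz⟩
  constructor
  · intro hz₀W u hu
    obtain ⟨T, hT, hz₀T, huT, hTd⟩ := hjoin u hu
    -- A point of `T` on `∂W` would be within `ε < δ` of `∂U`, contrary to the choice of `T`.
    refine hT.subset_of_disjoint_frontier hW ⟨z₀, hz₀T, hz₀W⟩ (fun v hv hvW => ?_) huT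
    linarith [hTd v hv, hWU v hvW]
  intro w hwK hwW
  have hUnorm : ∀ z ∈ frontier U, ‖z‖ ≤ R := fun z hz => by
    simpa using hR (frontier_subset_closure hz)
  have hWnorm : ∀ z ∈ frontier W, ‖z‖ ≤ R + 1 := fun z hz => by
    obtain ⟨z', hz', he⟩ := hWU' z hz
    have := norm_sub_norm_le z z'
    linarith [hUnorm z' hz']
  have hUpts : ∀ ζ₀ ∈ frontier U, ∃ ζ₁ ∈ frontier U, a₀ ≤ ‖ζ₁ - ζ₀‖ ∧ ‖ζ₁ - ζ₀‖ ≤ R₀ := by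
    intro ζ₀ hζ₀
    have hle : ∀ ζ₁ ∈ frontier U, ‖ζ₁ - ζ₀‖ ≤ R₀ := fun ζ₁ hζ₁ => by
      have := norm_sub_le ζ₁ ζ₀
      linarith [hUnorm ζ₁ hζ₁, hUnorm ζ₀ hζ₀]
    have htri := norm_sub_le_norm_sub_add_norm_sub x ζ₀ y
    rw [norm_sub_rev ζ₀ y] at htri
    by_cases hc : a₀ ≤ ‖x - ζ₀‖
    · exact ⟨x, hx, hc, hle x hx⟩
    · exact ⟨y, hy, by linarith, hle y hy⟩
  have hWpts : ∀ ζ₀ ∈ frontier W, ∃ ζ₁ ∈ frontier W, a₀ ≤ ‖ζ₁ - ζ₀‖ ∧ ‖ζ₁ - ζ₀‖ ≤ R₀ := by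
    intro ζ₀ hζ₀
    have hle : ∀ ζ₁ ∈ frontier W, ‖ζ₁ - ζ₀‖ ≤ R₀ := fun ζ₁ hζ₁ => by
      have := norm_sub_le ζ₁ ζ₀
      linarith [hWnorm ζ₁ hζ₁, hWnorm ζ₀ hζ₀]
    obtain ⟨x', hx', hxx'⟩ := hUW' x hx
    obtain ⟨y', hy', hyy'⟩ := hUW' y hy
    have t1 := norm_sub_le_norm_sub_add_norm_sub x x' y
    have t2 := norm_sub_le_norm_sub_add_norm_sub x' y' y
    have t3 := norm_sub_le_norm_sub_add_norm_sub x' ζ₀ y'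
    rw [norm_sub_rev y' y] at t2
    rw [norm_sub_rev ζ₀ y'] at t3
    by_cases hc : a₀ ≤ ‖x' - ζ₀‖
    · exact ⟨x', hx', hc, hle x' hx'⟩
    · exact ⟨y', hy', by linarith, hle y' hy'⟩
  have hwU := hKU hwK
  have hdU : d ≤ Metric.infDist w (frontier U) := hdK ▸ setDist_le_infDist ⟨x, hx⟩ hwK
  have hdW : d / 2 ≤ Metric.infDist w (frontier W) := by
    refine (Metric.le_infDist hWne).2 fun {v} hv => ?_
    obtain ⟨v', hv', he⟩ := hWU' v hv
    have := Metric.infDist_le_dist_of_mem (x := w) hv'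
    have htri := dist_triangle w v v'
    rw [dist_eq_norm v v'] at htri
    linarith
  obtain ⟨neU, leU⟩ := hΛ U w hU (closedBall_subset_of_lt_infDist hU hwU (by positivity) (by linarith))
  obtain ⟨neW, leW⟩ := hΛ W w hW (closedBall_subset_of_lt_infDist hW hwW (by positivity) (by linarith))
  -- Comparison in both directions; each multiplicative error becomes additive through the bound `Λ`
  -- on the density on the right-hand side.
  have c1 := hcomp U W ε a₀ R₀ w hU hε ⟨x, hx⟩ hWU hUpts h5 h6 h7 hwU (by linarith) neU
  have c2 := hcomp W U ε a₀ R₀ w hW hε hWne hUW hWpts h5 h6 h7 hwW (by linarith) neW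
  set L := Real.log (-Real.log (4 * ε)) with hL
  set ℓ := Real.log (Real.log (1 / ε)) with hℓ
  have hCL : C₁ / L ≤ 2 * C₁ * ℓ⁻¹ := by
    have hL0 : 0 < ℓ / 2 := by positivity
    calc C₁ / L ≤ C₁ / (ℓ / 2) := by gcongr
      _ = _ := by field_simp
  have hCL0 : 0 ≤ C₁ / L := div_nonneg hC₁.le (by linarith)
  have k1 : teichmullerDensity U w * (C₁ / L) ≤ Λ * (2 * C₁ * ℓ⁻¹) := by gcongr
  have k2 : teichmullerDensity W w * (C₁ / L) ≤ Λ * (2 * C₁ * ℓ⁻¹) := by gcongr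
  rw [abs_le]
  constructor <;> linarith
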